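/- Let $\eta>0$ and let $h:\mathbb R\to[0,\infty)$ be measurable with $h=0$ on $(-\infty,0)$ and $\int_{\mathbb R}h(t)\,dt<1$. Let $N$ be a strictly stationary, simple, locally finite point process on $\mathbb R$ with $\mathbb E[N(0,1]]<\infty$ which is a Hawkes process with immigration intensity $\eta$ and reproduction function $h$, i.e. which has, with respect to its internal history $\mathcal H_t=\sigma(N(B):B\subseteq(-\infty,t]\text{ Borel})$, the conditional intensity $$\lambda(t)=\eta+\int_{(-\infty,t)}h(t-u)\,N(du)=\eta+\sum_{T_i<t}h(t-T_i),$$ where the $T_i$ are the points of $N$; that is, $\mathbb E[N(a,b]\mid\mathcal H_a]=\mathbb E[\int_a^b\lambda(t)\,dt\mid\mathcal H_a]$ almost surely for all $a<b$. Put $m=\mathbb E[N(0,1]]$, let $\Delta>0$, and let $X_t=N\big((t\Delta,(t+1)\Delta]\big)$, $t\in\mathbb R$, be the bin-count process. Then $m=\eta\,\big(1-\int_{\mathbb R} h(t)\,dt\big)^{-1}$, the process $(X_t)_{t\in\mathbb R}$ is square-integrable and second-order stationary, and it has the spectral density $$f_c(\omega)=m\,\Delta\,\mathrm{sinc}^2\Big(\frac{\omega}{2}\Big)\,\Big|1-\widetilde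 h\Big(\frac{\omega}{\Delta}\Big)\Big|^{-2},\qquad \omega\in\mathbb R,$$ where $\widetilde h(\omega)=\int_{\mathbb R}h(s)e^{-i\omega s}\,ds$, $\mathrm{sinc}(x)=\sin(x)/x$ and $\mathrm{sinc}(0)=1$. That is, $f_c\ge0$, the functions $f_c$ and $r_c(u)=\operatorname{Cov}(X_0,X_u)$ are integrable on $\mathbb R$, and for all $\omega,u\in\mathbb R$ $$f_c(\omega)=\int_{\mathbb R}r_c(u)e^{-i\omega u}\,du,\qquad r_c(u)=\frac1{2\pi}\int_{\mathbb R}f_c(\omega)e^{i\omega u}\,d\omega.$$ -/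

import Mathlib

open MeasureTheory ProbabilityTheory Set

noncomputable section

namespace Hawkes

/-- The Fourier transform `∫ φ(s) e^{-iωs} ds` of a real function on the line. -/
def fourierT (φ : ℝ → ℝ) (ω : ℝ) : ℂ :=
  ∫ s : ℝ, (φ s : ℂ) * Complex.exp (-(Complex.I * (ω : ℂ) * (s : ℂ)))

/-- `ν` is a simple locally finite counting measure on the line: it counts the points of a
set that has finitely many points in every compact set. -/
def IsSimpleCounting (ν : Measure ℝ) : Prop :=
  ∃ S : Set ℝ, (∀ K : Set ℝ, IsCompact K → (S ∩ K).Finite) ∧ ν = Measure.count.restrict S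

/-- A simple locally finite point process on the line. The measurable structure on `Measure ℝ`
is the one generated by the evaluations `ν ↦ ν B`, `B` Borel. -/
structure IsPointProcess {Ω : Type*} [MeasurableSpace Ω] (N : Ω → Measure ℝ) : Prop where
  measurable : Measurable N
  counting : ∀ x, IsSimpleCounting (N x)

/-- The internal history of `N` at time `t`: the σ-algebra generated by the counts `N(B)` of
the Borel sets `B ⊆ (-∞, t]`. -/
@[reducible]
def history {Ω : Type*} (N : Ω → Measure ℝ) (t : ℝ) : MeasurableSpace Ω :=
  ⨆ (B : Set ℝ) (_ : MeasurableSet B) (_ : B ⊆ Iic t),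
    MeasurableSpace.comap (fun x => N x B) inferInstance

/-- `lam` is a conditional intensity of `N` with respect to its internal history: for `a < b`,
the conditional expectations of `N(a, b]` and of `∫_a^b lam(t) dt` given the history at time `a`
agree (they have the same integral over each event of that history). -/
def HasConditionalIntensity {Ω : Type*} [MeasurableSpace Ω] (P : Measure Ω) (N : Ω → Measure ℝ)
    (lam : ℝ → Ω → ENNReal) : Prop :=
  ∀ a b : ℝ, a < b → ∀ A : Set Ω, MeasurableSet[history N a] A →
    ∫⁻ x in A, N x (Ioc a b) ∂P = ∫⁻ x in A, (∫⁻ t in Ioc a b, lam t x) ∂P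

/-- The linear self-exciting intensity `η + ∫_{(-∞, t)} h(t - u) N(du) = η + ∑_{T_i < t} h(t - T_i)`
(for nonnegative `η` and `h`). -/
def hawkesIntensity {Ω : Type*} (N : Ω → Measure ℝ) (η : ℝ) (h : ℝ → ℝ) (t : ℝ) (x : Ω) :
    ENNReal :=
  ENNReal.ofReal η + ∫⁻ u in Iio t, ENNReal.ofReal (h (t - u)) ∂(N x)

/-- `N` is a (strictly) stationary Hawkes process of finite mean intensity, with immigration
intensity `η` and reproduction function `h`. -/
structure IsStationaryHawkes {Ω : Type*} [MeasurableSpace Ω] (P : Measure Ω) (N : Ω → Measure ℝ)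
    (η : ℝ) (h : ℝ → ℝ) : Prop where
  pointProcess : IsPointProcess N
  stationary : ∀ t : ℝ, IdentDistrib (fun x => (N x).map (fun s => s + t)) N P P
  finite_mean : ∫⁻ x, N x (Ioc 0 1) ∂P ≠ ⊤
  intensity : HasConditionalIntensity P N (hawkesIntensity N η h)

/-- The mean intensity `E[N(0, 1]]`. -/
def meanIntensity {Ω : Type*} [MeasurableSpace Ω] (P : Measure Ω) (N : Ω → Measure ℝ) : ℝ :=
  ∫ x, (N x (Ioc 0 1)).toReal ∂P

/-- The bin-count process `X_t = N((tΔ, (t+1)Δ])`, `t` real. -/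
def binCount {Ω : Type*} (N : Ω → Measure ℝ) (Δ : ℝ) (t : ℝ) (x : Ω) : ℝ :=
  (N x (Ioc (t * Δ) ((t + 1) * Δ))).toReal

/-- The autocovariance function `r(u) = Cov(X_0, X_u)`. -/
def autocov {Ω : Type*} [MeasurableSpace Ω] (P : Measure Ω) (X : ℝ → Ω → ℝ) (u : ℝ) : ℝ :=
  covariance (X 0) (X u) P

/-- A real process indexed by the line is second order stationary. -/
structure IsSecondOrderStationary {Ω : Type*} [MeasurableSpace Ω] (P : Measure Ω)
    (X : ℝ → Ω → ℝ) : Prop where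
  memLp : ∀ t, MemLp (X t) 2 P
  mean_eq : ∀ t, ∫ x, X t x ∂P = ∫ x, X 0 x ∂P
  cov_eq : ∀ t u, covariance (X t) (X (t + u)) P = autocov P X u

/-- The second order stationary process `X` has spectral density `f`: `f` is nonnegative and forms
a Fourier pair with the autocovariance function `r` of `X`,
`f(ω) = ∫ r(u) e^{-iωu} du` and `r(u) = (2π)⁻¹ ∫ f(ω) e^{iωu} dω`,
both integrals being absolutely convergent. -/
structure HasSpectralDensity {Ω : Type*} [MeasurableSpace Ω] (P : Measure Ω)
    (X : ℝ → Ω → ℝ) (f : ℝ → ℝ) : Prop where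
  stationary : IsSecondOrderStationary P X
  nonneg : ∀ ω, 0 ≤ f ω
  integrable : Integrable f
  integrable_autocov : Integrable (autocov P X)
  density_eq : ∀ ω : ℝ, (f ω : ℂ) = fourierT (autocov P X) ω
  autocov_eq : ∀ u : ℝ, (autocov P X u : ℂ) =
    1 / (2 * (Real.pi : ℂ)) *
      ∫ ω : ℝ, (f ω : ℂ) * Complex.exp (Complex.I * (ω : ℂ) * (u : ℂ))

end Hawkes

end

/-!
Write `Y_w = N(w, w + Δ]` and `M(I) = N(I) - ∫_I λ`. Integrating the intensity over a bin gives
`∫_{(w, w + Δ]} λ = η Δ + ∫ h(v) Y_{w - v} dv` (`compensator_Ioc_eq`), so that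
`Y_w = η Δ + ∫ h(v) Y_{w - v} dv + M(w, w + Δ]`. Expectations yield the mean rate
`m = η / (1 - ∫ h)`. The covariances follow from two facts about the compensated process `M`.

The first is that `M` has orthogonal increments of variance `m |I|`. The conditional intensity gives
`E ∫ Y dN = E ∫ Y λ dt` for all nonnegative predictable `Y` (`lintegral_predictable`), by a monotone
class argument. Used with `Y_t = N(a, t)` and `Y_t = ∫_a^t λ`, and combined with integration by parts
for the squares and the product of `N(I)` and `∫_I λ`, it gives
`E N(I)² + E (∫_I λ)² = E N(I) + 2 E N(I) ∫_I λ` as an identity in `[0, ∞]`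
(`IsStationaryHawkes.lintegral_sq_add_sq`). Stopping when the count and the compensator together
exceed `n` makes all the terms finite, and Fatou's lemma yields `E M(I)² ≤ m |I|` without any
assumption on second moments.

The second is that the counts are square integrable
(`IsStationaryHawkes.lintegral_count_sq_ne_top`). Multiplied by `min Y_0 K` and averaged, the
decomposition of `Y_0` bounds the truncated moment `E (min Y_0 K) Y_0` by a constant plus
`r E (min Y_0 K) Y_0` with `r < 1`, since `E (min Y_0 K) Y_v ≤ E (min Y_0 K) Y_0` by rearrangement.

With `γ(w) = Cov(Y_0, Y_w)` and `β(w) = E M(0, Δ] Y_w` the decomposition now reads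
`β(w) = ∫ h(v) β(w - v) dv + m |(0, Δ] ∩ (w, w + Δ]|` and `γ(w) = ∫ h(v) γ(w + v) dv + β(w)`.
Both functions are bounded and continuous, and such solutions of a renewal equation with integrable
inhomogeneity are integrable (`integrable_of_renewal`). Fourier transforms turn the equations into
`γ̂ |1 - ĥ|² = m |1̂_{(0, Δ]}|²`, which is the asserted density up to the change of scale by `Δ`. The
density is integrable, as `|1 - ĥ| ≥ 1 - ∫ h` and `sinc²` is integrable, and Fourier inversion for
the continuous function `γ` completes the proof.
-/

open scoped ENNReal

noncomputable section

namespace Hawkes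

section

/-! ### Measures on the line -/

/-- A kernel into the line with locally finite values is s-finite. Its values need not be uniformly
bounded on a bounded interval, so that the pieces in the sum are cut by the size of the mass too. -/
theorem isSFiniteKernel_of_forall_Ioc_lt_top {α : Type*} [MeasurableSpace α] (κ : Kernel α ℝ)
    (hκ : ∀ x (n : ℤ), κ x (Ioc (n : ℝ) (n + 1)) < ∞) : IsSFiniteKernel κ := by
  have hmeas : ∀ p : ℤ × ℕ, MeasurableSet
      {x | κ x (Ioc (p.1 : ℝ) (p.1 + 1)) ∈ Ico (p.2 : ℝ≥0∞) (p.2 + 1)} := fun p =>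
    (Kernel.measurable_coe κ measurableSet_Ioc) measurableSet_Ico
  classical
  let f : ℤ × ℕ → Kernel α ℝ := fun p =>
    Kernel.piecewise (hmeas p) (κ.restrict (s := Ioc (p.1 : ℝ) (p.1 + 1)) measurableSet_Ioc) 0
  have hf : ∀ p, IsFiniteKernel (f p) := by
    intro p
    refine ⟨⟨p.2 + 1, by finiteness, fun a => ?_⟩⟩
    by_cases ha : κ a (Ioc (p.1 : ℝ) (p.1 + 1)) ∈ Ico (p.2 : ℝ≥0∞) (p.2 + 1)
    · simp only [f, Kernel.piecewise_apply]
      rw [if_pos (by exact ha), Kernel.restrict_apply, Measure.restrict_apply_univ]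
      exact ha.2.le
    · simp only [f, Kernel.piecewise_apply]
      rw [if_neg (by exact ha)]
      simp
  have hsum : κ = Kernel.sum f := by
    refine Kernel.ext_iff'.2 fun x s hs => ?_
    rw [Kernel.sum_apply' _ _ hs, ENNReal.tsum_prod (f := fun n k => f (n, k) x s)]
    have h1 : ∀ n : ℤ, ∑' k : ℕ, f (n, k) x s = κ x (s ∩ Ioc (n : ℝ) (n + 1)) := by
      intro n
      have hlt := hκ x n
      lift κ x (Ioc (n : ℝ) (n + 1)) to NNReal using hlt.ne with c hc
      rw [tsum_eq_single ⌊c⌋₊]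
      · have hmem : κ x (Ioc (n : ℝ) (n + 1)) ∈ Ico ((⌊c⌋₊ : ℕ) : ℝ≥0∞) ((⌊c⌋₊ : ℕ) + 1) := by
          rw [← hc]
          constructor
          · exact_mod_cast Nat.floor_le (zero_le : 0 ≤ c)
          · exact_mod_cast Nat.lt_floor_add_one c
        simp only [f, Kernel.piecewise_apply]
        rw [if_pos (by exact hmem), Kernel.restrict_apply' _ _ _ hs]
      · intro k hk
        have hmem : κ x (Ioc (n : ℝ) (n + 1)) ∉ Ico ((k : ℕ) : ℝ≥0∞) ((k : ℕ) + 1) := by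
          rw [← hc]
          rintro ⟨h1, h2⟩
          apply hk
          symm
          rw [Nat.floor_eq_iff zero_le]
          exact ⟨by exact_mod_cast h1, by exact_mod_cast h2⟩
        simp only [f, Kernel.piecewise_apply]
        rw [if_neg (by exact hmem)]
        simp
    simp_rw [h1]
    rw [← measure_iUnion, ← inter_iUnion, iUnion_Ioc_intCast, inter_univ]
    · exact fun i j hij => (pairwise_disjoint_Ioc_intCast ℝ hij).mono
        inter_subset_right inter_subset_right
    · exact fun n => hs.inter measurableSet_Ioc
  rw [hsum]
  infer_instance

/-- Integration by parts for the product of the total masses of two measures on the line. -/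
theorem measure_univ_mul_measure_univ (μ ν : Measure ℝ) [SFinite μ] [SFinite ν] :
    μ univ * ν univ = ∫⁻ t, ν (Iio t) ∂μ + ∫⁻ t, μ (Iic t) ∂ν := by
  have hm : MeasurableSet {p : ℝ × ℝ | p.2 < p.1} := measurableSet_lt measurable_snd measurable_fst
  rw [← Measure.prod_prod, univ_prod_univ, ← measure_add_measure_compl hm,
    Measure.prod_apply hm, Measure.prod_apply_symm hm.compl]
  congr 1
  refine lintegral_congr fun t => congrArg μ ?_
  ext s
  simp

/-- The mass of an open interval, as a countable supremum over earlier rational end points. -/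
theorem measure_Ioo_eq_iSup (μ : Measure ℝ) (a t : ℝ) :
    μ (Ioo a t) = ⨆ q : ℚ, if (q : ℝ) < t then μ (Ioc a q) else 0 := by
  apply le_antisymm
  · have hU : Ioo a t = ⋃ q : {q : ℚ // (q : ℝ) < t}, Ioc a (q : ℝ) := by
      ext s
      simp only [mem_Ioo, mem_iUnion, mem_Ioc, Subtype.exists, exists_prop]
      constructor
      · rintro ⟨h1, h2⟩
        obtain ⟨q, hq1, hq2⟩ := exists_rat_btwn h2
        exact ⟨q, hq2, h1, hq1.le⟩
      · rintro ⟨q, h1, h2, h3⟩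
        exact ⟨h2, h3.trans_lt h1⟩
    have hd : Directed (· ⊆ ·) fun q : {q : ℚ // (q : ℝ) < t} => Ioc a (q : ℝ) :=
      Monotone.directed_le fun p q hpq => Ioc_subset_Ioc_right (by exact_mod_cast hpq)
    rw [hU, hd.measure_iUnion]
    refine iSup_le fun q => ?_
    exact le_iSup_of_le q.1 (by rw [if_pos q.2])
  · refine iSup_le fun q => ?_
    split_ifs with h
    · exact measure_mono fun s hs => ⟨hs.1, hs.2.trans_lt h⟩
    · exact zero_le

namespace IsSimpleCounting

variable {ν : Measure ℝ}

theorem exists_countable (hν : IsSimpleCounting ν) :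
    ∃ S : Set ℝ, S.Countable ∧ (∀ K : Set ℝ, IsCompact K → (S ∩ K).Finite) ∧
      ν = Measure.count.restrict S := by
  obtain ⟨S, hS, rfl⟩ := hν
  refine ⟨S, ?_, hS, rfl⟩
  have : S = ⋃ n : ℕ, S ∩ Icc (-(n : ℝ)) n := by
    rw [← inter_iUnion, eq_comm, inter_eq_left]
    intro s _
    obtain ⟨n, hn⟩ := exists_nat_ge |s|
    exact mem_iUnion.2 ⟨n, abs_le.1 hn⟩
  rw [this]
  exact countable_iUnion fun n => (hS _ isCompact_Icc).countable

theorem measure_lt_top_of_subset_Icc (hν : IsSimpleCounting ν) {B : Set ℝ} {a b : ℝ}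
    (hB : B ⊆ Icc a b) : ν B < ∞ := by
  obtain ⟨S, hc, hS, rfl⟩ := hν.exists_countable
  refine (measure_mono hB).trans_lt ?_
  rw [Measure.restrict_apply measurableSet_Icc, inter_comm, Measure.count_apply_lt_top]
  exact hS _ isCompact_Icc

theorem measure_Ioc_lt_top (hν : IsSimpleCounting ν) (a b : ℝ) : ν (Ioc a b) < ∞ :=
  hν.measure_lt_top_of_subset_Icc Ioc_subset_Icc_self

theorem sFinite (hν : IsSimpleCounting ν) : SFinite ν := by
  have : SigmaFinite ν := by
    refine ⟨⟨⟨fun n : ℕ => Icc (-(n : ℝ)) n, fun _ => trivial,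
      fun n => hν.measure_lt_top_of_subset_Icc subset_rfl, ?_⟩⟩⟩
    refine eq_univ_of_forall fun s => ?_
    obtain ⟨n, hn⟩ := exists_nat_ge |s|
    exact mem_iUnion.2 ⟨n, abs_le.1 hn⟩
  infer_instance

theorem ae_measure_singleton (hν : IsSimpleCounting ν) : ∀ᵐ t ∂ν, ν {t} = 1 := by
  obtain ⟨S, hc, hS, rfl⟩ := hν.exists_countable
  filter_upwards [ae_restrict_mem hc.measurableSet] with t ht
  rw [Measure.restrict_apply (measurableSet_singleton t), inter_eq_left.2 (by simpa using ht)]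
  simp

end IsSimpleCounting

end

section

/-! ### The history, the compensator and predictable integrands -/

variable {Ω : Type*}

/-- Joint measurability of the linear intensity. The measurable space of the first factor is a
parameter, in order that the statement applies to the history as well. -/
theorem measurable_linearIntensity {α : Type*} [MeasurableSpace α] (κ : Kernel α ℝ)
    [IsSFiniteKernel κ] (η : ℝ) {h : ℝ → ℝ} (h_meas : Measurable h) :
    Measurable fun p : α × ℝ =>
      ENNReal.ofReal η + ∫⁻ u in Iio p.2, ENNReal.ofReal (h (p.2 - u)) ∂(κ p.1) := by
  refine Measurable.const_add ?_ _
  have hf : Measurable fun q : (α × ℝ) × ℝ =>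
      (Iio q.1.2).indicator (fun u => ENNReal.ofReal (h (q.1.2 - u))) q.2 := by
    have : (fun q : (α × ℝ) × ℝ =>
        (Iio q.1.2).indicator (fun u => ENNReal.ofReal (h (q.1.2 - u))) q.2) =
        {q : (α × ℝ) × ℝ | q.2 < q.1.2}.indicator
          fun q => ENNReal.ofReal (h (q.1.2 - q.2)) := by
      ext q
      simp [indicator_apply]
    rw [this]
    refine Measurable.indicator (by fun_prop) ?_
    exact measurableSet_lt measurable_snd measurable_fst.snd
  have := Measurable.lintegral_kernel_prod_right' (κ := κ.comap Prod.fst measurable_fst) hf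
  simpa [lintegral_indicator measurableSet_Iio] using this

section Path

variable [MeasurableSpace Ω] {N : Ω → Measure ℝ}

/-- A point process as a kernel from the sample space to the line. -/
def pointKernel (hN : IsPointProcess N) : Kernel Ω ℝ := ⟨N, hN.measurable⟩

instance (hN : IsPointProcess N) : IsSFiniteKernel (pointKernel hN) :=
  isSFiniteKernel_of_forall_Ioc_lt_top _ fun x n => (hN.counting x).measure_Ioc_lt_top n (n + 1)

theorem IsPointProcess.measurable_coe (hN : IsPointProcess N) {B : Set ℝ} (hB : MeasurableSet B) :
    Measurable fun x => N x B :=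
  (Measure.measurable_coe hB).comp hN.measurable

theorem measurable_hawkesIntensity (hN : IsPointProcess N) (η : ℝ) {h : ℝ → ℝ}
    (h_meas : Measurable h) : Measurable fun p : Ω × ℝ => hawkesIntensity N η h p.2 p.1 :=
  measurable_linearIntensity (pointKernel hN) η h_meas

end Path

/-- The compensator `∫ λ(t) dt` of the linear self-exciting intensity, as a random measure. -/
def compensator (N : Ω → Measure ℝ) (η : ℝ) (h : ℝ → ℝ) (x : Ω) : Measure ℝ :=
  volume.withDensity fun t => hawkesIntensity N η h t x

instance (N : Ω → Measure ℝ) (η : ℝ) (h : ℝ → ℝ) (x : Ω) : SFinite (compensator N η h x) := by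
  unfold compensator; infer_instance

instance (N : Ω → Measure ℝ) (η : ℝ) (h : ℝ → ℝ) (x : Ω) :
    NullSingletonClass (compensator N η h x) := by
  unfold compensator; infer_instance

theorem history_mono (N : Ω → Measure ℝ) {s t : ℝ} (hst : s ≤ t) :
    history N s ≤ history N t := by
  refine iSup_mono fun B => iSup_mono fun hB => ?_
  exact iSup_mono' fun h => ⟨h.trans (Iic_subset_Iic.2 hst), le_rfl⟩

theorem measurable_history_coe (N : Ω → Measure ℝ) {t : ℝ} {B : Set ℝ}
    (hB : MeasurableSet B) (hBt : B ⊆ Iic t) : Measurable[history N t] fun x => N x B := by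
  have h1 : MeasurableSpace.comap (fun x => N x B) inferInstance ≤ history N t :=
    le_iSup_of_le B (le_iSup_of_le hB (le_iSup_of_le hBt le_rfl))
  exact (comap_measurable fun x => N x B).mono h1 le_rfl

theorem compensator_Ioc (N : Ω → Measure ℝ) (η : ℝ) (h : ℝ → ℝ) (x : Ω) (a b : ℝ) :
    compensator N η h x (Ioc a b) = ∫⁻ t in Ioc a b, hawkesIntensity N η h t x :=
  withDensity_apply _ measurableSet_Ioc

/-- The predictable σ-algebra of the internal history of `N`, generated by the sets `A × (s, ∞)`
with `A` in the history at time `s`. -/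
@[reducible]
def predictable (N : Ω → Measure ℝ) : MeasurableSpace (Ω × ℝ) :=
  MeasurableSpace.generateFrom {E | ∃ s A, MeasurableSet[history N s] A ∧ E = A ×ˢ Ioi s}

theorem measurableSet_predictable {N : Ω → Measure ℝ} {s : ℝ} {A : Set Ω} (hA : MeasurableSet[history N s] A) :
    MeasurableSet[predictable N] (A ×ˢ Ioi s) :=
  MeasurableSpace.measurableSet_generateFrom ⟨s, A, hA, rfl⟩

theorem isPiSystem_predictable (N : Ω → Measure ℝ) :
    IsPiSystem {E | ∃ s A, MeasurableSet[history N s] A ∧ E = A ×ˢ Ioi s} := by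
  rintro _ ⟨s, A, hA, rfl⟩ _ ⟨t, B, hB, rfl⟩ -
  refine ⟨max s t, A ∩ B, ?_, ?_⟩
  · exact MeasurableSet.inter (history_mono N (le_max_left s t) A hA)
      (history_mono N (le_max_right s t) B hB)
  · rw [prod_inter_prod, Ioi_inter_Ioi]

theorem measurable_predictable_ite {N : Ω → Measure ℝ} {s : ℝ} {f : Ω → ℝ≥0∞} (hf : Measurable[history N s] f) :
    Measurable[predictable N] fun p : Ω × ℝ => if s < p.2 then f p.1 else 0 := by
  refine measurable_of_Ioi fun c => ?_
  have : (fun p : Ω × ℝ => if s < p.2 then f p.1 else 0) ⁻¹' Ioi c = (f ⁻¹' Ioi c) ×ˢ Ioi s := by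
    ext p
    by_cases hp : s < p.2 <;> simp [hp]
  rw [this]
  exact measurableSet_predictable (hf measurableSet_Ioi)

/-- Open intervals that end at the running time make a random measure predictable, if the
half-closed ones make it adapted. -/
theorem measurable_predictable_Ioo {N : Ω → Measure ℝ} (μ : Ω → Measure ℝ) (a : ℝ)
    (hμ : ∀ q, Measurable[history N q] fun x => μ x (Ioc a q)) :
    Measurable[predictable N] fun p : Ω × ℝ => μ p.1 (Ioo a p.2) := by
  simp_rw [measure_Ioo_eq_iSup]
  exact Measurable.iSup fun q : ℚ =>
    measurable_predictable_ite (hμ q)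

variable [MeasurableSpace Ω] {N : Ω → Measure ℝ}

theorem history_le (hN : IsPointProcess N) (t : ℝ) : history N t ≤ ‹MeasurableSpace Ω› := by
  refine iSup_le fun B => iSup_le fun hB => iSup_le fun _ => ?_
  exact (hN.measurable_coe hB).comap_le

/-- The compensator of `(a, b]` is known at time `b`: up to that time the intensity only depends on
the restriction of the point process to `(-∞, b]`. -/
theorem measurable_history_compensator (hN : IsPointProcess N) (η : ℝ) {h : ℝ → ℝ}
    (h_meas : Measurable h) (a b : ℝ) :
    Measurable[history N b] fun x => compensator N η h x (Ioc a b) := by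
  let Nb : Ω → Measure ℝ := fun x => (N x).restrict (Iic b)
  have hNb : Measurable[history N b] Nb := by
    refine @Measure.measurable_of_measurable_coe _ _ _ (history N b) _ fun B hB => ?_
    have : (fun x => Nb x B) = fun x => N x (B ∩ Iic b) := by
      ext x; exact Measure.restrict_apply hB
    rw [this]
    exact measurable_history_coe N (hB.inter measurableSet_Iic) inter_subset_right
  let κ : @Kernel Ω ℝ (history N b) _ := @Kernel.mk Ω ℝ (history N b) _ Nb hNb
  have hκ : @IsSFiniteKernel Ω ℝ (history N b) _ κ := by
    refine @isSFiniteKernel_of_forall_Ioc_lt_top Ω (history N b) κ fun x n => ?_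
    exact (Measure.restrict_apply_le _ _).trans_lt ((hN.counting x).measure_Ioc_lt_top _ _)
  have h1 := @measurable_linearIntensity Ω (history N b) κ hκ η h h_meas
  have h2 := @Measurable.lintegral_prod_right' Ω ℝ (history N b) _
    (volume.restrict (Ioc a b)) _ _ h1
  convert h2 using 2 with x
  rw [compensator_Ioc]
  refine setLIntegral_congr_fun measurableSet_Ioc fun t ht => ?_
  have : (Nb x).restrict (Iio t) = (N x).restrict (Iio t) := by
    rw [Measure.restrict_restrict measurableSet_Iio,
      inter_eq_left.2 (show Iio t ⊆ Iic b from fun u (hu : u < t) => hu.le.trans ht.2)]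
  show _ = ENNReal.ofReal η + ∫⁻ u in Iio t, ENNReal.ofReal (h (t - u)) ∂(Nb x)
  rw [this]
  rfl

theorem predictable_le (hN : IsPointProcess N) :
    predictable N ≤ (inferInstance : MeasurableSpace (Ω × ℝ)) := by
  refine MeasurableSpace.generateFrom_le ?_
  rintro _ ⟨s, A, hA, rfl⟩
  exact (history_le hN s A hA).prod measurableSet_Ioi

/-- The defining property of the conditional intensity extends from the indicators of the generating
sets to all nonnegative predictable integrands. -/
theorem lintegral_predictable (P : Measure Ω) [IsProbabilityMeasure P] (hN : IsPointProcess N)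
    {η : ℝ} {h : ℝ → ℝ} (h_meas : Measurable h)
    (hint : HasConditionalIntensity P N (hawkesIntensity N η h)) {a b : ℝ}
    (hfin : ∫⁻ x, N x (Ioc a b) ∂P ≠ ∞) {Y : Ω × ℝ → ℝ≥0∞} (hY : Measurable[predictable N] Y) :
    ∫⁻ x, ∫⁻ t in Ioc a b, Y (x, t) ∂(N x) ∂P =
      ∫⁻ x, ∫⁻ t in Ioc a b, Y (x, t) ∂(compensator N η h x) ∂P := by
  have hY' : Measurable Y := hY.mono (predictable_le hN) le_rfl
  have hlam := measurable_hawkesIntensity hN η h_meas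
  let Q₁ : Measure (Ω × ℝ) := P ⊗ₘ ((pointKernel hN).restrict (measurableSet_Ioc (a := a) (b := b)))
  let Q₂ : Measure (Ω × ℝ) := (P.prod (volume.restrict (Ioc a b))).withDensity
    fun p => hawkesIntensity N η h p.2 p.1
  have hQ₁ : ∀ Z : Ω × ℝ → ℝ≥0∞, Measurable Z →
      ∫⁻ p, Z p ∂Q₁ = ∫⁻ x, ∫⁻ t in Ioc a b, Z (x, t) ∂(N x) ∂P := by
    intro Z hZ
    rw [Measure.lintegral_compProd hZ]
    rfl
  have hQ₂ : ∀ Z : Ω × ℝ → ℝ≥0∞, Measurable Z →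
      ∫⁻ p, Z p ∂Q₂ = ∫⁻ x, ∫⁻ t in Ioc a b, Z (x, t) ∂(compensator N η h x) ∂P := by
    intro Z hZ
    rw [lintegral_withDensity_eq_lintegral_mul _ hlam hZ, lintegral_prod _ (by fun_prop)]
    refine lintegral_congr fun x => ?_
    rw [compensator, restrict_withDensity measurableSet_Ioc,
      lintegral_withDensity_eq_lintegral_mul _
        (show Measurable fun t => hawkesIntensity N η h t x from hlam.comp measurable_prodMk_left)
        (show Measurable fun t => Z (x, t) from hZ.comp measurable_prodMk_left)]
    rfl
  have hgen : ∀ (s : ℝ) (A : Set Ω), MeasurableSet[history N s] A →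
      Q₁ (A ×ˢ Ioi s) = Q₂ (A ×ˢ Ioi s) := by
    intro s A hA
    have hA' := history_le hN s A hA
    have hm : MeasurableSet (A ×ˢ Ioi s) := hA'.prod measurableSet_Ioi
    have key : ∀ μ : Ω → Measure ℝ,
        ∫⁻ x, ∫⁻ t in Ioc a b, (A ×ˢ Ioi s).indicator (fun _ => (1 : ℝ≥0∞)) (x, t) ∂(μ x) ∂P =
          ∫⁻ x in A, μ x (Ioc (max a s) b) ∂P := by
      intro μ
      rw [← lintegral_indicator hA']
      refine lintegral_congr fun x => ?_
      by_cases hx : x ∈ A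
      · have : ∀ t, (A ×ˢ Ioi s).indicator (fun _ => (1 : ℝ≥0∞)) (x, t) =
            (Ioi s).indicator 1 t := by
          intro t; simp [indicator, hx]
        simp_rw [this, indicator_of_mem hx]
        rw [lintegral_indicator_one measurableSet_Ioi, Measure.restrict_apply measurableSet_Ioi,
          inter_comm, Ioc_inter_Ioi]
      · have : ∀ t, (A ×ˢ Ioi s).indicator (fun _ => (1 : ℝ≥0∞)) (x, t) = 0 := by
          intro t; simp [hx]
        simp_rw [this, indicator_of_notMem hx]
        simp
    rw [← lintegral_indicator_one hm, ← lintegral_indicator_one hm]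
    have h1 := hQ₁ _ (measurable_const.indicator hm (f := fun _ => (1 : ℝ≥0∞)))
    have h2 := hQ₂ _ (measurable_const.indicator hm (f := fun _ => (1 : ℝ≥0∞)))
    rw [key] at h1 h2
    refine h1.trans (Eq.trans ?_ h2.symm)
    rcases le_or_gt b (max a s) with hb | hb
    · simp [Ioc_eq_empty_of_le hb]
    · simp_rw [compensator_Ioc]
      exact hint _ _ hb A (history_mono N (le_max_right a s) A hA)
  have huniv : Q₁ univ = ∫⁻ x, N x (Ioc a b) ∂P := by
    have := hQ₁ (fun _ => 1) measurable_const
    simpa using this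
  -- the whole space is not one of the generators, but the measures sit on `Ω × (a, b]`
  have hunivs : Q₁ univ = Q₂ univ := by
    have h1 : Q₁ univ = Q₁ (univ ×ˢ Ioi a) := by
      have h1 := hQ₁ ((univ ×ˢ Ioi a).indicator fun _ => 1)
        (measurable_const.indicator (MeasurableSet.univ.prod measurableSet_Ioi))
      rw [← lintegral_indicator_one (MeasurableSet.univ.prod measurableSet_Ioi)]
      refine huniv.trans (Eq.trans ?_ h1.symm)
      refine lintegral_congr fun x => ?_
      have : ∫⁻ t in Ioc a b, ((univ : Set Ω) ×ˢ Ioi a).indicator (fun _ => (1 : ℝ≥0∞)) (x, t) ∂(N x) =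
          ∫⁻ t in Ioc a b, 1 ∂(N x) :=
        setLIntegral_congr_fun measurableSet_Ioc fun t ht => by simp [ht.1]
      rw [this]; simp
    have h2 : Q₂ univ = Q₂ (univ ×ˢ Ioi a) := by
      have h1 := hQ₂ ((univ ×ˢ Ioi a).indicator fun _ => 1)
        (measurable_const.indicator (MeasurableSet.univ.prod measurableSet_Ioi))
      have h0 := hQ₂ (fun _ => 1) measurable_const
      rw [← lintegral_indicator_one (MeasurableSet.univ.prod measurableSet_Ioi),
        ← lintegral_one]
      refine h0.trans (Eq.trans ?_ h1.symm)
      refine lintegral_congr fun x => ?_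
      exact setLIntegral_congr_fun measurableSet_Ioc fun t ht => by simp [ht.1]
    rw [h1, h2]
    exact hgen a univ (@MeasurableSet.univ _ (history N a))
  have hle := predictable_le hN
  have htrim : Q₁.trim hle = Q₂.trim hle := by
    have hf : IsFiniteMeasure Q₁ := ⟨by rw [huniv]; exact hfin.lt_top⟩
    refine ext_of_generate_finite _ rfl (isPiSystem_predictable N) ?_ ?_
    · rintro E ⟨s, A, hA, rfl⟩
      rw [trim_measurableSet_eq hle (measurableSet_predictable hA),
        trim_measurableSet_eq hle (measurableSet_predictable hA)]
      exact hgen s A hA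
    · rw [trim_measurableSet_eq hle (@MeasurableSet.univ _ (predictable N)),
        trim_measurableSet_eq hle (@MeasurableSet.univ _ (predictable N))]
      exact hunivs
  rw [← hQ₁ Y hY', ← hQ₂ Y hY', ← lintegral_trim hle hY, ← lintegral_trim hle hY, htrim]

end

section

variable {Ω : Type*} [MeasurableSpace Ω] {P : Measure Ω} {N : Ω → Measure ℝ} {η : ℝ} {h : ℝ → ℝ}

/-! ### First order moments -/

/-- The parameters of a subcritical linear self-exciting process. -/
structure IsSubcritical (η : ℝ) (h : ℝ → ℝ) : Prop where
  immigration_nonneg : 0 ≤ η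
  measurable : Measurable h
  nonneg : ∀ t, 0 ≤ h t
  eq_zero_of_neg : ∀ t, t < 0 → h t = 0
  integrable : Integrable h
  integral_lt_one : ∫ t, h t < 1

/-- The mean intensity, in terms of the parameters. -/
def rate (η : ℝ) (h : ℝ → ℝ) : ℝ := η / (1 - ∫ t, h t)

theorem IsSubcritical.rate_nonneg (hs : IsSubcritical η h) : 0 ≤ rate η h :=
  div_nonneg hs.immigration_nonneg (by linarith [hs.integral_lt_one])

theorem IsSubcritical.rate_eq (hs : IsSubcritical η h) :
    η + (∫ t, h t) * rate η h = rate η h := by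
  have : 1 - ∫ t, h t ≠ 0 := by linarith [hs.integral_lt_one]
  unfold rate
  field_simp
  ring

theorem measurable_count_Ioc (hN : IsPointProcess N) (Δ : ℝ) :
    Measurable fun p : Ω × ℝ => N p.1 (Ioc p.2 (p.2 + Δ)) := by
  have hs : MeasurableSet {q : (Ω × ℝ) × ℝ | q.1.2 < q.2 ∧ q.2 ≤ q.1.2 + Δ} :=
    (measurableSet_lt measurable_fst.snd measurable_snd).inter
      (measurableSet_le measurable_snd (measurable_fst.snd.add_const Δ))
  have := Kernel.measurable_kernel_prodMk_left
    (κ := (pointKernel hN).comap (Prod.fst : Ω × ℝ → Ω) measurable_fst) hs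
  exact this

/-- The compensator of an interval is a mixture of the counts of its translates into the past, with
weight `h`. This identity is the source of all renewal equations below. -/
theorem compensator_Ioc_eq (hN : IsPointProcess N) (hη : 0 ≤ η) (h_meas : Measurable h)
    (h_neg : ∀ t, t < 0 → h t = 0) (Δ w : ℝ) (x : Ω) :
    compensator N η h x (Ioc w (w + Δ)) =
      ENNReal.ofReal (η * Δ) + ∫⁻ v, ENNReal.ofReal (h v) * N x (Ioc (w - v) (w - v + Δ)) := by
  have := (hN.counting x).sFinite
  rw [compensator_Ioc]
  unfold hawkesIntensity
  rw [lintegral_add_left measurable_const, setLIntegral_const, Real.volume_Ioc, add_sub_cancel_left,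
    ← ENNReal.ofReal_mul hη]
  congr 1
  have hm : Measurable fun p : ℝ × ℝ =>
      (Iio p.1).indicator (fun u => ENNReal.ofReal (h (p.1 - u))) p.2 := by
    have : (fun p : ℝ × ℝ => (Iio p.1).indicator (fun u => ENNReal.ofReal (h (p.1 - u))) p.2) =
        {p : ℝ × ℝ | p.2 < p.1}.indicator fun p => ENNReal.ofReal (h (p.1 - p.2)) := by
      ext p; simp [indicator_apply]
    rw [this]
    exact Measurable.indicator (by fun_prop) (measurableSet_lt measurable_snd measurable_fst)
  have hm2 : Measurable fun p : ℝ × ℝ =>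
      (Ioc w (w + Δ)).indicator (fun _ => ENNReal.ofReal (h p.2)) (p.2 + p.1) := by
    have : (fun p : ℝ × ℝ =>
        (Ioc w (w + Δ)).indicator (fun _ => ENNReal.ofReal (h p.2)) (p.2 + p.1)) =
        ((fun p : ℝ × ℝ => p.2 + p.1) ⁻¹' Ioc w (w + Δ)).indicator
          fun p => ENNReal.ofReal (h p.2) := by
      ext p; rfl
    rw [this]
    exact Measurable.indicator (by fun_prop) (measurableSet_Ioc.preimage (by fun_prop))
  calc ∫⁻ t in Ioc w (w + Δ), ∫⁻ u in Iio t, ENNReal.ofReal (h (t - u)) ∂(N x)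
      = ∫⁻ t in Ioc w (w + Δ), ∫⁻ u,
          (Iio t).indicator (fun u => ENNReal.ofReal (h (t - u))) u ∂(N x) := by
        simp_rw [lintegral_indicator measurableSet_Iio]
    _ = ∫⁻ u, (∫⁻ t in Ioc w (w + Δ),
          (Iio t).indicator (fun u => ENNReal.ofReal (h (t - u))) u) ∂(N x) :=
        lintegral_lintegral_swap (f := fun t u =>
          (Iio t).indicator (fun u => ENNReal.ofReal (h (t - u))) u) hm.aemeasurable
    _ = ∫⁻ u, (∫⁻ v, (Ioc w (w + Δ)).indicator (fun _ => ENNReal.ofReal (h v)) (v + u)) ∂(N x) := by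
        refine lintegral_congr fun u => ?_
        rw [← lintegral_indicator measurableSet_Ioc, ← lintegral_add_right_eq_self _ u]
        refine lintegral_congr_ae ?_
        -- the single value `h 0`, which the intensity ignores, is irrelevant
        filter_upwards [compl_mem_ae_iff.2 (measure_singleton (μ := volume) (0 : ℝ))] with v hv'
        by_cases h1 : v + u ∈ Ioc w (w + Δ)
        · rw [indicator_of_mem h1, indicator_of_mem h1]
          rcases lt_or_gt_of_ne (show v ≠ 0 from hv') with h2 | h2
          · simp [h_neg v h2, h2.le]
          · simp [h2]
        · rw [indicator_of_notMem h1, indicator_of_notMem h1]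
    _ = ∫⁻ v, ∫⁻ u, (Ioc w (w + Δ)).indicator (fun _ => ENNReal.ofReal (h v)) (v + u) ∂(N x) :=
        lintegral_lintegral_swap (f := fun u v =>
          (Ioc w (w + Δ)).indicator (fun _ => ENNReal.ofReal (h v)) (v + u)) hm2.aemeasurable
    _ = _ := by
        refine lintegral_congr fun v => ?_
        have : ∀ u, (Ioc w (w + Δ)).indicator (fun _ => ENNReal.ofReal (h v)) (v + u) =
            (Ioc (w - v) (w - v + Δ)).indicator (fun _ => ENNReal.ofReal (h v)) u := by
          intro u
          have : v + u ∈ Ioc w (w + Δ) ↔ u ∈ Ioc (w - v) (w - v + Δ) := by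
            simp only [mem_Ioc]
            constructor <;> rintro ⟨h1, h2⟩ <;> constructor <;> linarith
          simp [indicator_apply, this]
        simp_rw [this]
        rw [lintegral_indicator measurableSet_Ioc, setLIntegral_const]

/-- The counts of two intervals, translated simultaneously, keep their joint distribution. -/
theorem IsStationaryHawkes.identDistrib_pair (hN : IsStationaryHawkes P N η h) (Δ s t r : ℝ) :
    IdentDistrib (fun x => (N x (Ioc (s + r) (s + r + Δ)), N x (Ioc (t + r) (t + r + Δ))))
      (fun x => (N x (Ioc s (s + Δ)), N x (Ioc t (t + Δ)))) P P := by
  have hF : Measurable fun ν : Measure ℝ => (ν (Ioc s (s + Δ)), ν (Ioc t (t + Δ))) :=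
    (Measure.measurable_coe measurableSet_Ioc).prodMk (Measure.measurable_coe measurableSet_Ioc)
  have h1 := (hN.stationary (-r)).comp hF
  have key : ∀ x c, (N x).map (fun s => s + -r) (Ioc c (c + Δ)) = N x (Ioc (c + r) (c + r + Δ)) := by
    intro x c
    rw [Measure.map_apply (by fun_prop) measurableSet_Ioc]
    congr 1
    ext u
    simp only [mem_preimage, mem_Ioc]
    constructor <;> rintro ⟨h1, h2⟩ <;> constructor <;> linarith
  simpa only [Function.comp_def, key] using h1

theorem IsStationaryHawkes.identDistrib_count (hN : IsStationaryHawkes P N η h) (Δ s : ℝ) :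
    IdentDistrib (fun x => N x (Ioc s (s + Δ))) (fun x => N x (Ioc 0 (0 + Δ))) P P := by
  have := (hN.identDistrib_pair Δ 0 0 s).comp measurable_fst
  simpa [Function.comp_def] using this

theorem IsStationaryHawkes.lintegral_compensator (hN : IsStationaryHawkes P N η h) (a b : ℝ) :
    ∫⁻ x, compensator N η h x (Ioc a b) ∂P = ∫⁻ x, N x (Ioc a b) ∂P := by
  rcases le_or_gt b a with hab | hab
  · simp [Ioc_eq_empty_of_le hab]
  · have := hN.intensity a b hab univ (@MeasurableSet.univ _ (history N a))
    simp only [Measure.restrict_univ] at this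
    rw [this]
    simp_rw [compensator_Ioc]

theorem IsStationaryHawkes.lintegral_count_ne_top (hN : IsStationaryHawkes P N η h) (a b : ℝ) :
    ∫⁻ x, N x (Ioc a b) ∂P ≠ ∞ := by
  have h1 : ∀ n : ℕ, ∫⁻ x, N x (Ioc a (a + n)) ∂P ≠ ∞ := by
    intro n
    induction n with
    | zero => simp
    | succ n ih =>
      have hle : ∀ x, N x (Ioc a (a + (n + 1 : ℕ))) ≤
          N x (Ioc a (a + n)) + N x (Ioc (a + n) (a + n + 1)) := by
        intro x
        refine (measure_mono ?_).trans (measure_union_le _ _)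
        rw [Ioc_union_Ioc_eq_Ioc (by simp) (by simp)]
        push_cast
        rw [add_assoc]
      have h2 : ∫⁻ x, N x (Ioc (a + n) (a + n + 1)) ∂P ≠ ∞ := by
        have := (hN.identDistrib_count 1 (a + n)).lintegral_eq
        rw [this]
        simpa using hN.finite_mean
      refine ne_top_of_le_ne_top (ENNReal.add_ne_top.2 ⟨ih, h2⟩) ?_
      rw [← lintegral_add_left (hN.pointProcess.measurable_coe measurableSet_Ioc)]
      exact lintegral_mono hle
  obtain ⟨n, hn⟩ := exists_nat_ge (b - a)
  refine ne_top_of_le_ne_top (h1 n) (lintegral_mono fun x => measure_mono ?_)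
  exact Ioc_subset_Ioc_right (by linarith)

/-- Integrals of the compensator against a nonnegative weight, in terms of those of the counts. -/
theorem lintegral_mul_compensator [SFinite P] (hN : IsPointProcess N) (hη : 0 ≤ η)
    (h_meas : Measurable h) (h_neg : ∀ t, t < 0 → h t = 0) (Δ w : ℝ)
    {Z : Ω → ℝ≥0∞} (hZ : Measurable Z) :
    ∫⁻ x, Z x * compensator N η h x (Ioc w (w + Δ)) ∂P =
      ENNReal.ofReal (η * Δ) * ∫⁻ x, Z x ∂P +
        ∫⁻ v, ENNReal.ofReal (h v) * ∫⁻ x, Z x * N x (Ioc (w - v) (w - v + Δ)) ∂P := by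
  have hc := measurable_count_Ioc hN Δ
  have hm : Measurable fun p : Ω × ℝ =>
      ENNReal.ofReal (h p.2) * N p.1 (Ioc (w - p.2) (w - p.2 + Δ)) := by
    have h2 : Measurable fun p : Ω × ℝ => N p.1 (Ioc (w - p.2) (w - p.2 + Δ)) :=
      hc.comp (measurable_fst.prodMk (measurable_const.sub measurable_snd))
    exact (h_meas.ennreal_ofReal.comp measurable_snd).mul h2
  simp_rw [compensator_Ioc_eq hN hη h_meas h_neg, mul_add]
  rw [lintegral_add_left (by fun_prop), lintegral_mul_const _ hZ, mul_comm]
  congr 1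
  have hsec : ∀ v, Measurable fun x => Z x * N x (Ioc (w - v) (w - v + Δ)) := fun v =>
    hZ.mul (hN.measurable_coe measurableSet_Ioc)
  calc ∫⁻ x, Z x * (∫⁻ v, ENNReal.ofReal (h v) * N x (Ioc (w - v) (w - v + Δ))) ∂P
      = ∫⁻ x, (∫⁻ v, Z x * (ENNReal.ofReal (h v) * N x (Ioc (w - v) (w - v + Δ)))) ∂P := by
        refine lintegral_congr fun x => ?_
        rw [lintegral_const_mul]
        exact hm.comp measurable_prodMk_left
    _ = ∫⁻ v, ∫⁻ x, Z x * (ENNReal.ofReal (h v) * N x (Ioc (w - v) (w - v + Δ))) ∂P :=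
        lintegral_lintegral_swap (f := fun x v =>
          Z x * (ENNReal.ofReal (h v) * N x (Ioc (w - v) (w - v + Δ))))
          ((hZ.comp measurable_fst).mul hm).aemeasurable
    _ = _ := by
        refine lintegral_congr fun v => ?_
        rw [← lintegral_const_mul _ (hsec v)]
        refine lintegral_congr fun x => ?_
        ring

/-- The mean of the counts: taking expectations in the formula for the compensator gives a linear
equation for it. -/
theorem IsStationaryHawkes.lintegral_count [IsProbabilityMeasure P]
    (hN : IsStationaryHawkes P N η h) (hsub : IsSubcritical η h) {Δ : ℝ} (hΔ : 0 ≤ Δ) (w : ℝ) :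
    ∫⁻ x, N x (Ioc w (w + Δ)) ∂P = ENNReal.ofReal (rate η h * Δ) := by
  obtain ⟨hη, h_meas, h_nonneg, h_neg, h_int, h_lt⟩ := hsub
  have hs : ∀ w, ∫⁻ x, N x (Ioc w (w + Δ)) ∂P = ∫⁻ x, N x (Ioc 0 (0 + Δ)) ∂P := fun w =>
    (hN.identDistrib_count Δ w).lintegral_eq
  have h1 := lintegral_mul_compensator (P := P) hN.pointProcess hη h_meas h_neg Δ 0
    (Z := fun _ => 1) measurable_const
  simp only [one_mul, hN.lintegral_compensator, lintegral_const, measure_univ, mul_one] at h1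
  simp_rw [hs (_ - _)] at h1
  rw [hs w]
  have hfin := hN.lintegral_count_ne_top 0 (0 + Δ)
  rw [lintegral_mul_const _ (by fun_prop),
    ← ofReal_integral_eq_lintegral_ofReal h_int (Filter.Eventually.of_forall h_nonneg)] at h1
  generalize ∫⁻ x, N x (Ioc 0 (0 + Δ)) ∂P = e at h1 hfin
  lift e to NNReal using hfin
  have hρ : 0 ≤ ∫ t, h t := integral_nonneg h_nonneg
  have h2 := congrArg ENNReal.toReal h1
  rw [ENNReal.toReal_add (by simp) (by finiteness), ENNReal.toReal_mul,
    ENNReal.toReal_ofReal (by positivity), ENNReal.toReal_ofReal hρ] at h2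
  simp only [ENNReal.coe_toReal] at h2
  have h3 : (e : ℝ) = rate η h * Δ := by
    unfold rate
    have : (1 - ∫ t, h t) ≠ 0 := by linarith
    field_simp
    linarith
  rw [← h3, ENNReal.ofReal_coe_nnreal]

end

section

variable {Ω : Type*} {N : Ω → Measure ℝ} {η : ℝ} {h : ℝ → ℝ}

/-! ### The variance of the compensated process -/

/-- Integration by parts on an initial piece `D` of `(a, ∞)`. -/
theorem measure_mul_measure_of_initial (μ ν : Measure ℝ) [SFinite μ] [SFinite ν] {a : ℝ} {D : Set ℝ}
    (hD : MeasurableSet D) (hDa : D ⊆ Ioi a) (hDi : ∀ t ∈ D, Ioc a t ⊆ D) :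
    μ D * ν D = ∫⁻ t in D, ν (Ioo a t) ∂μ + ∫⁻ t in D, μ (Ioc a t) ∂ν := by
  have key := measure_univ_mul_measure_univ (μ.restrict D) (ν.restrict D)
  rw [Measure.restrict_apply_univ, Measure.restrict_apply_univ] at key
  rw [key]
  congr 1
  · refine setLIntegral_congr_fun hD fun t ht => ?_
    show ν.restrict D (Iio t) = _
    rw [Measure.restrict_apply measurableSet_Iio]
    congr 1
    ext s
    exact ⟨fun hs => ⟨hDa hs.2, hs.1⟩, fun hs => ⟨hs.2, hDi t ht ⟨hs.1, hs.2.le⟩⟩⟩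
  · refine setLIntegral_congr_fun hD fun t ht => ?_
    show μ.restrict D (Iic t) = _
    rw [Measure.restrict_apply measurableSet_Iic]
    congr 1
    ext s
    exact ⟨fun hs => ⟨hDa hs.2, hs.1⟩, fun hs => ⟨hs.2, hDi t ht hs⟩⟩

theorem measure_Ioc_eq_Ioo_add (μ : Measure ℝ) {a t : ℝ} (hat : a < t) :
    μ (Ioc a t) = μ (Ioo a t) + μ {t} := by
  rw [← Ioo_union_right hat, measure_union (by simp) (measurableSet_singleton t)]

/-- For a simple point measure the diagonal term of the square is the measure itself. -/
theorem IsSimpleCounting.measure_sq_of_initial {ν : Measure ℝ} (hν : IsSimpleCounting ν) {a : ℝ}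
    {D : Set ℝ} (hD : MeasurableSet D) (hDa : D ⊆ Ioi a) (hDi : ∀ t ∈ D, Ioc a t ⊆ D) :
    ν D * ν D = ν D + 2 * ∫⁻ t in D, ν (Ioo a t) ∂ν := by
  have := hν.sFinite
  have h1 : ∫⁻ t in D, ν (Ioc a t) ∂ν = ∫⁻ t in D, (ν (Ioo a t) + 1) ∂ν := by
    refine setLIntegral_congr_fun_ae hD ?_
    filter_upwards [hν.ae_measure_singleton] with t ht htD
    rw [measure_Ioc_eq_Ioo_add _ (hDa htD), ht]
  rw [measure_mul_measure_of_initial ν ν hD hDa hDi, h1, lintegral_add_right _ measurable_const,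
    setLIntegral_const]
  ring

/-- Without atoms in one of the measures there is no diagonal term. -/
theorem measure_mul_measure_of_initial' (μ ν : Measure ℝ) [SFinite μ] [SFinite ν]
    [NullSingletonClass μ] {a : ℝ} {D : Set ℝ} (hD : MeasurableSet D) (hDa : D ⊆ Ioi a)
    (hDi : ∀ t ∈ D, Ioc a t ⊆ D) :
    μ D * ν D = ∫⁻ t in D, ν (Ioo a t) ∂μ + ∫⁻ t in D, μ (Ioo a t) ∂ν := by
  rw [measure_mul_measure_of_initial μ ν hD hDa hDi]
  congr 1
  refine setLIntegral_congr_fun hD fun t ht => ?_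
  simp only [measure_Ioc_eq_Ioo_add μ (hDa ht), measure_singleton, add_zero]

/-- The times in `(a, b]` until the number of points and the compensator, both counted from time
`a`, exceed `n` together. -/
def localizedIoc (N : Ω → Measure ℝ) (η : ℝ) (h : ℝ → ℝ) (a b : ℝ) (n : ℝ≥0∞) (x : Ω) : Set ℝ :=
  {t | N x (Ioo a t) + compensator N η h x (Ioo a t) ≤ n} ∩ Ioc a b

theorem measurableSet_localizedIoc_aux (N : Ω → Measure ℝ) (η : ℝ) (h : ℝ → ℝ) (a : ℝ) (n : ℝ≥0∞)
    (x : Ω) : MeasurableSet {t | N x (Ioo a t) + compensator N η h x (Ioo a t) ≤ n} := by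
  refine OrdConnected.measurableSet ⟨fun s _ t ht r hr => ?_⟩
  have h1 : Ioo a r ⊆ Ioo a t := Ioo_subset_Ioo_right hr.2
  exact (add_le_add (measure_mono h1) (measure_mono h1)).trans ht

theorem measurableSet_localizedIoc (N : Ω → Measure ℝ) (η : ℝ) (h : ℝ → ℝ) (a b : ℝ) (n : ℝ≥0∞)
    (x : Ω) : MeasurableSet (localizedIoc N η h a b n x) :=
  (measurableSet_localizedIoc_aux N η h a n x).inter measurableSet_Ioc

theorem localizedIoc_initial (N : Ω → Measure ℝ) (η : ℝ) (h : ℝ → ℝ) (a b : ℝ) (n : ℝ≥0∞)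
    (x : Ω) : ∀ t ∈ localizedIoc N η h a b n x, Ioc a t ⊆ localizedIoc N η h a b n x := by
  rintro t ⟨h1, h2⟩ s hs
  have h3 : Ioo a s ⊆ Ioo a t := Ioo_subset_Ioo_right hs.2
  exact ⟨(add_le_add (measure_mono h3) (measure_mono h3)).trans h1, hs.1, hs.2.trans h2.2⟩

theorem localizedIoc_eq_Ioc {a b : ℝ} {n : ℝ≥0∞} {x : Ω}
    (hn : N x (Ioc a b) + compensator N η h x (Ioc a b) ≤ n) :
    localizedIoc N η h a b n x = Ioc a b := by
  refine inter_eq_right.2 fun t ht => ?_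
  have h1 : Ioo a t ⊆ Ioc a b := fun s hs => ⟨hs.1, hs.2.le.trans ht.2⟩
  exact (add_le_add (measure_mono h1) (measure_mono h1)).trans hn

open Classical in
theorem setLIntegral_localizedIoc (μ : Measure ℝ) (a b : ℝ) (n : ℝ≥0∞) (x : Ω) (f : ℝ → ℝ≥0∞) :
    ∫⁻ t in localizedIoc N η h a b n x, f t ∂μ = ∫⁻ t in Ioc a b,
      (if N x (Ioo a t) + compensator N η h x (Ioo a t) ≤ n then f t else 0) ∂μ := by
  rw [localizedIoc, ← Measure.restrict_restrict (measurableSet_localizedIoc_aux N η h a n x),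
    ← lintegral_indicator (measurableSet_localizedIoc_aux N η h a n x)]
  simp only [indicator_apply, mem_ofPred_eq]

theorem measurable_predictable_count (N : Ω → Measure ℝ) (a : ℝ) :
    Measurable[predictable N] fun p : Ω × ℝ => N p.1 (Ioo a p.2) :=
  measurable_predictable_Ioo N a fun _ =>
    measurable_history_coe N measurableSet_Ioc Ioc_subset_Iic_self

variable [MeasurableSpace Ω] {P : Measure Ω}

theorem measurable_lintegral_count (hN : IsPointProcess N) (a b : ℝ) {Y : Ω × ℝ → ℝ≥0∞}
    (hY : Measurable Y) : Measurable fun x => ∫⁻ t in Ioc a b, Y (x, t) ∂(N x) :=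
  hY.lintegral_kernel_prod_right'
    (κ := (pointKernel hN).restrict (measurableSet_Ioc (a := a) (b := b)))

theorem measurable_lintegral_compensator (hN : IsPointProcess N) (h_meas : Measurable h) (a b : ℝ)
    {Y : Ω × ℝ → ℝ≥0∞} (hY : Measurable Y) :
    Measurable fun x => ∫⁻ t in Ioc a b, Y (x, t) ∂(compensator N η h x) := by
  have hlam := measurable_hawkesIntensity hN η h_meas
  have h1 := (hlam.mul hY).lintegral_prod_right' (ν := volume.restrict (Ioc a b))
  convert h1 using 2 with x
  rw [compensator, restrict_withDensity measurableSet_Ioc,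
      lintegral_withDensity_eq_lintegral_mul _
        (show Measurable fun t => hawkesIntensity N η h t x from hlam.comp measurable_prodMk_left)
        (show Measurable fun t => Y (x, t) from hY.comp measurable_prodMk_left)]
  rfl

theorem measurable_compensator_Ioc (hN : IsPointProcess N) (h_meas : Measurable h) (a b : ℝ) :
    Measurable fun x => compensator N η h x (Ioc a b) := by
  simpa using measurable_lintegral_compensator (η := η) hN h_meas a b (Y := fun _ => 1)
    measurable_const

theorem measurable_predictable_compensator (hN : IsPointProcess N) (η : ℝ) (h_meas : Measurable h)
    (a : ℝ) : Measurable[predictable N] fun p : Ω × ℝ => compensator N η h p.1 (Ioo a p.2) :=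
  measurable_predictable_Ioo _ a fun q => measurable_history_compensator hN η h_meas a q

theorem measurableSet_predictable_localized (hN : IsPointProcess N) (h_meas : Measurable h)
    (a : ℝ) (n : ℝ≥0∞) : MeasurableSet[predictable N]
      {p : Ω × ℝ | N p.1 (Ioo a p.2) + compensator N η h p.1 (Ioo a p.2) ≤ n} :=
  ((measurable_predictable_count N a).add (measurable_predictable_compensator hN η h_meas a))
    measurableSet_Iic

theorem measurable_count_localized (hN : IsPointProcess N) (h_meas : Measurable h) (a b : ℝ)
    (n : ℝ≥0∞) : Measurable fun x => N x (localizedIoc N η h a b n x) := by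
  classical
  have h0 : ∀ x, N x (localizedIoc N η h a b n x) = ∫⁻ t in Ioc a b,
      (fun p : Ω × ℝ => if N p.1 (Ioo a p.2) + compensator N η h p.1 (Ioo a p.2) ≤ n
        then (1 : ℝ≥0∞) else 0) (x, t) ∂(N x) := fun x => by
    rw [← setLIntegral_one, setLIntegral_localizedIoc]
  simp_rw [h0]
  exact measurable_lintegral_count hN a b (Measurable.ite
    (predictable_le hN _ (measurableSet_predictable_localized hN h_meas a n))
      measurable_const measurable_const)

theorem measurable_compensator_localized (hN : IsPointProcess N) (h_meas : Measurable h) (a b : ℝ)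
    (n : ℝ≥0∞) : Measurable fun x => compensator N η h x (localizedIoc N η h a b n x) := by
  classical
  have h0 : ∀ x, compensator N η h x (localizedIoc N η h a b n x) = ∫⁻ t in Ioc a b,
      (fun p : Ω × ℝ => if N p.1 (Ioo a p.2) + compensator N η h p.1 (Ioo a p.2) ≤ n
        then (1 : ℝ≥0∞) else 0) (x, t) ∂(compensator N η h x) := fun x => by
    rw [← setLIntegral_one, setLIntegral_localizedIoc]
  simp_rw [h0]
  exact measurable_lintegral_compensator hN h_meas a b (Measurable.ite
    (predictable_le hN _ (measurableSet_predictable_localized hN h_meas a n))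
      measurable_const measurable_const)

/-- The variance identity of the compensated process, before any subtraction: it needs no second
moments. -/
theorem IsStationaryHawkes.lintegral_sq_add_sq [IsProbabilityMeasure P]
    (hN : IsStationaryHawkes P N η h) (h_meas : Measurable h) (a b : ℝ) (n : ℝ≥0∞) :
    ∫⁻ x, N x (localizedIoc N η h a b n x) ^ 2 ∂P +
        ∫⁻ x, compensator N η h x (localizedIoc N η h a b n x) ^ 2 ∂P =
      ∫⁻ x, N x (localizedIoc N η h a b n x) ∂P +
        2 * ∫⁻ x, N x (localizedIoc N η h a b n x) *
          compensator N η h x (localizedIoc N η h a b n x) ∂P := by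
  classical
  have hpp := hN.pointProcess
  set C := compensator N η h
  have hV := measurableSet_predictable_localized (η := η) hpp h_meas a n
  let Y₁ : Ω × ℝ → ℝ≥0∞ := fun p =>
    if N p.1 (Ioo a p.2) + C p.1 (Ioo a p.2) ≤ n then N p.1 (Ioo a p.2) else 0
  let Y₂ : Ω × ℝ → ℝ≥0∞ := fun p =>
    if N p.1 (Ioo a p.2) + C p.1 (Ioo a p.2) ≤ n then C p.1 (Ioo a p.2) else 0
  have hY₁ : Measurable[predictable N] Y₁ :=
    Measurable.ite hV (measurable_predictable_count N a) measurable_const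
  have hY₂ : Measurable[predictable N] Y₂ :=
    Measurable.ite hV (measurable_predictable_compensator hpp η h_meas a) measurable_const
  have hle := predictable_le hpp
  have hfin := hN.lintegral_count_ne_top a b
  have e₁ := lintegral_predictable P hpp h_meas hN.intensity hfin hY₁
  have e₂ := lintegral_predictable P hpp h_meas hN.intensity hfin hY₂
  have hAm := measurable_count_localized (η := η) hpp h_meas a b n
  have hin := localizedIoc_initial N η h a b n
  have hms := measurableSet_localizedIoc N η h a b n
  have hsub : ∀ x, localizedIoc N η h a b n x ⊆ Ioi a := fun x t ht => ht.2.1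
  have hA2 : ∀ x, N x (localizedIoc N η h a b n x) ^ 2 = N x (localizedIoc N η h a b n x) +
      2 * ∫⁻ t in Ioc a b, Y₁ (x, t) ∂(N x) := fun x => by
    rw [sq, (hpp.counting x).measure_sq_of_initial (hms x) (hsub x) (hin x),
      setLIntegral_localizedIoc]
  have hB2 : ∀ x, C x (localizedIoc N η h a b n x) ^ 2 =
      2 * ∫⁻ t in Ioc a b, Y₂ (x, t) ∂(C x) := fun x => by
    rw [sq, measure_mul_measure_of_initial' (C x) (C x) (hms x) (hsub x) (hin x),
      setLIntegral_localizedIoc, two_mul]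
  have hAB : ∀ x, N x (localizedIoc N η h a b n x) * C x (localizedIoc N η h a b n x) =
      ∫⁻ t in Ioc a b, Y₁ (x, t) ∂(C x) + ∫⁻ t in Ioc a b, Y₂ (x, t) ∂(N x) := fun x => by
    have := (hpp.counting x).sFinite
    rw [mul_comm, measure_mul_measure_of_initial' (C x) (N x) (hms x) (hsub x) (hin x),
      setLIntegral_localizedIoc, setLIntegral_localizedIoc]
  have m₁ := measurable_lintegral_compensator (η := η) hpp h_meas a b (hY₁.mono hle le_rfl)
  simp_rw [hA2, hB2, hAB]
  rw [lintegral_add_left hAm, lintegral_const_mul' _ _ (by simp), lintegral_const_mul' _ _ (by simp),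
    lintegral_add_left m₁, e₁, e₂]
  ring

/-- The counts up to the localizing time are bounded, since `c² ≤ c + 2nc` for their number `c`. -/
theorem count_localizedIoc_le (hN : IsPointProcess N) (a b : ℝ) (n : ℝ≥0∞) (x : Ω) :
    N x (localizedIoc N η h a b n x) ≤ 1 + 2 * n := by
  set D := localizedIoc N η h a b n x
  have hms := measurableSet_localizedIoc N η h a b n x
  have h1 := (hN.counting x).measure_sq_of_initial hms (fun t ht => ht.2.1)
    (localizedIoc_initial N η h a b n x)
  have h2 : ∫⁻ t in D, N x (Ioo a t) ∂(N x) ≤ n * N x D := by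
    rw [← setLIntegral_const]
    exact setLIntegral_mono' hms fun t ht => le_self_add.trans ht.1
  have hfin : N x D ≠ ∞ :=
    ((measure_mono inter_subset_right).trans_lt ((hN.counting x).measure_Ioc_lt_top a b)).ne
  rcases eq_or_ne (N x D) 0 with h0 | h0
  · rw [h0]; exact zero_le
  · refine (ENNReal.mul_le_mul_iff_left h0 hfin).1 ?_
    rw [h1]
    calc _ ≤ N x D + 2 * (n * N x D) := by gcongr
      _ = _ := by ring

end

section

variable {Ω : Type*} [MeasurableSpace Ω] {P : Measure Ω} {N : Ω → Measure ℝ} {η : ℝ} {h : ℝ → ℝ}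

/-- Fatou's lemma for a sequence that becomes stationary at almost every point. -/
theorem lintegral_le_of_eventually_eq {α : Type*} [MeasurableSpace α] {μ : Measure α}
    {f : ℕ → α → ℝ≥0∞} {g : α → ℝ≥0∞} (hf : ∀ n, Measurable (f n))
    (hfg : ∀ᵐ x ∂μ, ∀ᶠ n in Filter.atTop, f n x = g x) {c : ℝ≥0∞} (hc : ∀ n, ∫⁻ x, f n x ∂μ ≤ c) :
    ∫⁻ x, g x ∂μ ≤ c := by
  have h1 : ∫⁻ x, g x ∂μ = ∫⁻ x, Filter.liminf (fun n => f n x) Filter.atTop ∂μ := by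
    refine lintegral_congr_ae ?_
    filter_upwards [hfg] with x hx
    exact (tendsto_const_nhds.congr' (hx.mono fun n hn => hn.symm)).liminf_eq.symm
  rw [h1]
  refine (lintegral_liminf_le hf).trans ?_
  refine (Filter.liminf_le_liminf (Filter.Eventually.of_forall hc)).trans ?_
  simp

/-- The square of a difference, in a form that involves no subtraction of extended reals. -/
theorem ofReal_sq_sub_add {u v : ℝ≥0∞} (hu : u ≠ ∞) (hv : v ≠ ∞) :
    ENNReal.ofReal ((u.toReal - v.toReal) ^ 2) + 2 * (u * v) = u ^ 2 + v ^ 2 := by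
  lift u to NNReal using hu
  lift v to NNReal using hv
  simp only [ENNReal.coe_toReal]
  have h1 : (2 * (u * v) : ℝ≥0∞) = ENNReal.ofReal (2 * (u * v)) := by
    rw [ENNReal.ofReal_mul (by norm_num), ENNReal.ofReal_mul (by simp)]
    simp
  have h2 : ((u : ℝ≥0∞) ^ 2 + (v : ℝ≥0∞) ^ 2) = ENNReal.ofReal (u ^ 2 + v ^ 2) := by
    rw [ENNReal.ofReal_add (by positivity) (by positivity), ENNReal.ofReal_pow (by simp),
      ENNReal.ofReal_pow (by simp)]
    simp
  rw [h1, h2, ← ENNReal.ofReal_add (by positivity) (by positivity)]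
  congr 1
  ring

/-- The increment over `(a, b]` of the compensated process, as a real number. It is only meaningful
where the compensator is finite, which is the case almost surely. -/
def compensated (N : Ω → Measure ℝ) (η : ℝ) (h : ℝ → ℝ) (a b : ℝ) (x : Ω) : ℝ :=
  (N x (Ioc a b)).toReal - (compensator N η h x (Ioc a b)).toReal

theorem IsStationaryHawkes.ae_compensator_lt_top (hN : IsStationaryHawkes P N η h)
    (h_meas : Measurable h) (a b : ℝ) : ∀ᵐ x ∂P, compensator N η h x (Ioc a b) < ∞ :=
  ae_lt_top (measurable_compensator_Ioc hN.pointProcess h_meas a b)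
    (by rw [hN.lintegral_compensator]; exact hN.lintegral_count_ne_top a b)

/-- The compensated process has finite variance, whether or not the counts do: localization makes
all terms of the variance identity finite, and Fatou's lemma removes it. -/
theorem IsStationaryHawkes.lintegral_compensated_sq_le [IsProbabilityMeasure P]
    (hN : IsStationaryHawkes P N η h) (h_meas : Measurable h) (a b : ℝ) :
    ∫⁻ x, ENNReal.ofReal (compensated N η h a b x ^ 2) ∂P ≤ ∫⁻ x, N x (Ioc a b) ∂P := by
  have hpp := hN.pointProcess
  have hCfin := hN.ae_compensator_lt_top h_meas a b
  let D : ℕ → Ω → Set ℝ := fun n => localizedIoc N η h a b n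
  have hAm : ∀ n, Measurable fun x => N x (D n x) := fun n =>
    measurable_count_localized hpp h_meas a b n
  have hBm : ∀ n, Measurable fun x => compensator N η h x (D n x) := fun n =>
    measurable_compensator_localized hpp h_meas a b n
  refine lintegral_le_of_eventually_eq (f := fun n x =>
    ENNReal.ofReal (((N x (D n x)).toReal - (compensator N η h x (D n x)).toReal) ^ 2)) ?_ ?_ ?_
  · intro n
    exact (((hAm n).ennreal_toReal.sub (hBm n).ennreal_toReal).pow_const 2).ennreal_ofReal
  · filter_upwards [hCfin] with x hx
    have hlt := ENNReal.add_lt_top.2 ⟨(hpp.counting x).measure_Ioc_lt_top a b, hx⟩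
    obtain ⟨k, hk⟩ := ENNReal.exists_nat_gt hlt.ne
    filter_upwards [Filter.eventually_ge_atTop k] with n hn
    have : D n x = Ioc a b := localizedIoc_eq_Ioc (hk.le.trans (by exact_mod_cast hn))
    rw [this, compensated]
  · intro n
    have hid := hN.lintegral_sq_add_sq h_meas a b n
    have hAB : ∫⁻ x, N x (D n x) * compensator N η h x (D n x) ∂P ≠ ∞ := by
      refine ne_top_of_le_ne_top (b := (1 + 2 * n) * ∫⁻ x, compensator N η h x (Ioc a b) ∂P) ?_ ?_
      · rw [hN.lintegral_compensator]
        have := hN.lintegral_count_ne_top a b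
        finiteness
      · rw [← lintegral_const_mul' _ _ (by finiteness)]
        refine lintegral_mono fun x => ?_
        exact mul_le_mul' (count_localizedIoc_le hpp a b n x) (measure_mono inter_subset_right)
    have hsum : ∫⁻ x, ENNReal.ofReal
          (((N x (D n x)).toReal - (compensator N η h x (D n x)).toReal) ^ 2) ∂P +
        2 * ∫⁻ x, N x (D n x) * compensator N η h x (D n x) ∂P =
        ∫⁻ x, N x (D n x) ∂P + 2 * ∫⁻ x, N x (D n x) * compensator N η h x (D n x) ∂P := by
      rw [← hid, ← lintegral_const_mul' _ _ (by simp),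
        ← lintegral_add_right _ (show Measurable fun x =>
          2 * (N x (D n x) * compensator N η h x (D n x)) from
            ((hAm n).mul (hBm n)).const_mul 2),
        ← lintegral_add_left ((hAm n).pow_const 2)]
      refine lintegral_congr_ae ?_
      filter_upwards [hCfin] with x hx
      refine ofReal_sq_sub_add ?_ ?_
      · exact ((measure_mono inter_subset_right).trans_lt
          ((hpp.counting x).measure_Ioc_lt_top a b)).ne
      · exact ((measure_mono inter_subset_right).trans_lt hx).ne
    rw [ENNReal.add_left_inj (by finiteness)] at hsum
    rw [hsum]
    exact lintegral_mono fun x => measure_mono inter_subset_right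

/-! ### Square integrability of the counts -/

/-- A rearrangement inequality that, for two variables of equal law, bounds the mixed truncated
moment by the pure one. -/
theorem two_mul_min_mul_add_sq_le {x y : ℝ≥0∞} (hx : x ≠ ∞) (hy : y ≠ ∞) (K : ℕ) :
    2 * (min x K * y) + min y K ^ 2 ≤ 2 * (min y K * y) + min x K ^ 2 := by
  lift x to NNReal using hx
  lift y to NNReal using hy
  have key : ∀ a b k : ℝ, 0 ≤ a → 0 ≤ b → 0 ≤ k →
      2 * (min a k * b) + min b k ^ 2 ≤ 2 * (min b k * b) + min a k ^ 2 := by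
    intro a b k ha hb hk
    rcases le_total b k with h1 | h1
    · rw [min_eq_left h1]; nlinarith [sq_nonneg (min a k - b)]
    · rw [min_eq_right h1]
      have h2 : min a k ≤ k := min_le_right a k
      nlinarith [mul_nonneg (sub_nonneg.2 h2) (sub_nonneg.2 h1), sq_nonneg (min a k - k)]
  have := key x y K x.2 y.2 (by positivity)
  have h2 : 2 * (min x K * y) + min y K ^ 2 ≤ 2 * (min y K * y) + min x (K : NNReal) ^ 2 := by
    rw [← NNReal.coe_le_coe]
    push_cast
    exact this
  exact_mod_cast h2

/-- Stationarity makes the rearrangement inequality applicable to the counts of two intervals of equal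
length, however they overlap. -/
theorem IsStationaryHawkes.lintegral_min_mul_le [IsProbabilityMeasure P]
    (hN : IsStationaryHawkes P N η h) (Δ w : ℝ) (K : ℕ) :
    ∫⁻ x, min (N x (Ioc 0 (0 + Δ))) K * N x (Ioc w (w + Δ)) ∂P ≤
      ∫⁻ x, min (N x (Ioc 0 (0 + Δ))) K * N x (Ioc 0 (0 + Δ)) ∂P := by
  have hpp := hN.pointProcess
  have hid := hN.identDistrib_count Δ w
  have m0 := hpp.measurable_coe (measurableSet_Ioc (a := (0 : ℝ)) (b := 0 + Δ))
  have mw := hpp.measurable_coe (measurableSet_Ioc (a := w) (b := w + Δ))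
  have h1 : ∫⁻ x, min (N x (Ioc w (w + Δ))) K ^ 2 ∂P = ∫⁻ x, min (N x (Ioc 0 (0 + Δ))) K ^ 2 ∂P :=
    (hid.comp (u := fun y : ℝ≥0∞ => min y K ^ 2) (by fun_prop)).lintegral_eq
  have h2 : ∫⁻ x, min (N x (Ioc w (w + Δ))) K * N x (Ioc w (w + Δ)) ∂P =
      ∫⁻ x, min (N x (Ioc 0 (0 + Δ))) K * N x (Ioc 0 (0 + Δ)) ∂P :=
    (hid.comp (u := fun y : ℝ≥0∞ => min y K * y) (by fun_prop)).lintegral_eq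
  have hfin : ∫⁻ x, min (N x (Ioc 0 (0 + Δ))) K ^ 2 ∂P ≠ ∞ := by
    refine ne_top_of_le_ne_top (b := (K : ℝ≥0∞) ^ 2) (by finiteness) ?_
    refine (lintegral_mono fun x => pow_le_pow_left₀ (zero_le) (min_le_right _ _) 2).trans ?_
    simp
  have h3 := lintegral_mono (μ := P) fun x => two_mul_min_mul_add_sq_le
    ((hpp.counting x).measure_Ioc_lt_top 0 (0 + Δ)).ne
    ((hpp.counting x).measure_Ioc_lt_top w (w + Δ)).ne K
  rw [lintegral_add_right _ (by fun_prop), lintegral_add_right _ (by fun_prop), h1,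
    ENNReal.add_le_add_iff_right hfin, lintegral_const_mul' _ _ (by simp),
    lintegral_const_mul' _ _ (by simp), h2,
    ENNReal.mul_le_mul_iff_right (by simp) (by simp)] at h3
  exact h3

/-- Young's inequality with a parameter. -/
theorem ofReal_mul_abs_le {ε : ℝ} (hε : 0 < ε) {y : ℝ≥0∞} (hy : y ≠ ∞) (z : ℝ) :
    y * ENNReal.ofReal |z| ≤
      ENNReal.ofReal ε * y ^ 2 + ENNReal.ofReal (1 / (4 * ε)) * ENNReal.ofReal (z ^ 2) := by
  lift y to NNReal using hy
  rw [← ENNReal.ofReal_coe_nnreal, ← ENNReal.ofReal_pow (by simp), ← ENNReal.ofReal_mul (by simp),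
    ← ENNReal.ofReal_mul hε.le, ← ENNReal.ofReal_mul (by positivity),
    ← ENNReal.ofReal_add (by positivity) (by positivity)]
  refine ENNReal.ofReal_le_ofReal ?_
  have h1 : 1 / (4 * ε) * z ^ 2 = (|z| / (2 * ε)) ^ 2 * ε := by
    rw [div_pow, sq_abs]; field_simp; ring
  have h2 : |z| = 2 * ε * (|z| / (2 * ε)) := by field_simp
  rw [h1]
  set t := |z| / (2 * ε)
  rw [h2]
  nlinarith [mul_nonneg hε.le (sq_nonneg ((y : ℝ) - t))]

/-- The counts are square integrable: their truncated second moments `c` satisfy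
`c ≤ A + r c` with `r < 1` and `A` independent of the truncation. -/
theorem IsStationaryHawkes.lintegral_count_sq_ne_top [IsProbabilityMeasure P]
    (hN : IsStationaryHawkes P N η h) (hs : IsSubcritical η h) (Δ : ℝ) :
    ∫⁻ x, N x (Ioc 0 (0 + Δ)) ^ 2 ∂P ≠ ∞ := by
  obtain ⟨hη, h_meas, h_nonneg, h_neg, h_int, h_lt⟩ := hs
  have hpp := hN.pointProcess
  set Y : Ω → ℝ≥0∞ := fun x => N x (Ioc 0 (0 + Δ)) with hY
  have mY : Measurable Y := hpp.measurable_coe measurableSet_Ioc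
  have hYfin : ∀ x, Y x ≠ ∞ := fun x => ((hpp.counting x).measure_Ioc_lt_top _ _).ne
  have hEY : ∫⁻ x, Y x ∂P ≠ ∞ := hN.lintegral_count_ne_top _ _
  set ρ := ∫ t, h t with hρdef
  have hρ : 0 ≤ ρ := integral_nonneg h_nonneg
  -- half of the gap `1 - ρ` absorbs the quadratic term of Young's inequality
  set ε := (1 - ρ) / 2 with hεdef
  have hε : 0 < ε := by rw [hεdef]; linarith
  have hM := hN.lintegral_compensated_sq_le h_meas 0 (0 + Δ)
  set A := ENNReal.ofReal (η * Δ) * ∫⁻ x, Y x ∂P +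
    ENNReal.ofReal (1 / (4 * ε)) *
      ∫⁻ x, ENNReal.ofReal (compensated N η h 0 (0 + Δ) x ^ 2) ∂P with hA
  have hAfin : A ≠ ∞ := by
    have := ne_top_of_le_ne_top hEY hM
    finiteness
  have mC : Measurable fun x => compensator N η h x (Ioc 0 (0 + Δ)) :=
    measurable_compensator_Ioc hpp h_meas _ _
  have mM : Measurable fun x => compensated N η h 0 (0 + Δ) x :=
    mY.ennreal_toReal.sub mC.ennreal_toReal
  have hbound : ∀ K : ℕ, ∫⁻ x, min (Y x) K * Y x ∂P ≤ ENNReal.ofReal (A.toReal / ε) := by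
    intro K
    set c := ∫⁻ x, min (Y x) K * Y x ∂P with hc
    have hcfin : c ≠ ∞ := by
      refine ne_top_of_le_ne_top (b := K * ∫⁻ x, Y x ∂P) (by finiteness) ?_
      rw [← lintegral_const_mul' _ _ (by simp)]
      exact lintegral_mono fun x => mul_le_mul_left (min_le_right _ _) _
    have hψ : Measurable fun x => min (Y x) K := mY.min measurable_const
    have hψ_le : ∀ x, min (Y x) K ≤ Y x := fun x => min_le_left _ _
    have hψfin : ∀ x, min (Y x) K ≠ ∞ := fun x => ne_top_of_le_ne_top (hYfin x) (hψ_le x)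
    have h1 : c ≤ ∫⁻ x, min (Y x) K * compensator N η h x (Ioc 0 (0 + Δ)) ∂P +
        ∫⁻ x, min (Y x) K * ENNReal.ofReal |compensated N η h 0 (0 + Δ) x| ∂P := by
      rw [← lintegral_add_left (show Measurable fun x =>
        min (Y x) K * compensator N η h x (Ioc 0 (0 + Δ)) from hψ.mul mC)]
      refine lintegral_mono fun x => ?_
      rw [← mul_add]
      refine mul_le_mul_right ?_ _
      -- where the compensator is infinite, the real increment is meaningless but the bound trivial
      rcases eq_or_ne (compensator N η h x (Ioc 0 (0 + Δ))) ∞ with h0 | h0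
      · rw [h0]; simp
      · rw [← ENNReal.ofReal_toReal h0, ← ENNReal.ofReal_add (by simp) (abs_nonneg _),
          ← ENNReal.ofReal_toReal (hYfin x)]
        refine ENNReal.ofReal_le_ofReal ?_
        have := le_abs_self (compensated N η h 0 (0 + Δ) x)
        simp only [compensated] at this ⊢
        linarith
    have h2 : ∫⁻ x, min (Y x) K * compensator N η h x (Ioc 0 (0 + Δ)) ∂P ≤
        ENNReal.ofReal (η * Δ) * ∫⁻ x, Y x ∂P + ENNReal.ofReal ρ * c := by
      rw [lintegral_mul_compensator hpp hη h_meas h_neg Δ 0 hψ]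
      refine add_le_add (mul_le_mul_right (lintegral_mono hψ_le) _) ?_
      rw [hρdef, ofReal_integral_eq_lintegral_ofReal h_int (Filter.Eventually.of_forall h_nonneg),
        ← lintegral_mul_const _ (by fun_prop)]
      exact lintegral_mono fun v => mul_le_mul_right (hN.lintegral_min_mul_le Δ (0 - v) K) _
    have h3 : ∫⁻ x, min (Y x) K * ENNReal.ofReal |compensated N η h 0 (0 + Δ) x| ∂P ≤
        ENNReal.ofReal ε * c + ENNReal.ofReal (1 / (4 * ε)) *
          ∫⁻ x, ENNReal.ofReal (compensated N η h 0 (0 + Δ) x ^ 2) ∂P := by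
      rw [hc, ← lintegral_const_mul' _ _ (by simp), ← lintegral_const_mul' _ _ (by simp),
        ← lintegral_add_right _ (by fun_prop)]
      refine lintegral_mono fun x => (ofReal_mul_abs_le hε (hψfin x) _).trans ?_
      gcongr
      rw [sq]
      gcongr
      exact hψ_le x
    have h4 : c ≤ A + ENNReal.ofReal (ρ + ε) * c := by
      rw [ENNReal.ofReal_add hρ hε.le]
      calc c ≤ _ := h1
        _ ≤ _ := add_le_add h2 h3
        _ = _ := by rw [hA]; ring
    rw [← ENNReal.ofReal_toReal hcfin]
    refine ENNReal.ofReal_le_ofReal ?_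
    have h5 := ENNReal.toReal_mono (by finiteness) h4
    rw [ENNReal.toReal_add hAfin (by finiteness), ENNReal.toReal_mul,
      ENNReal.toReal_ofReal (by positivity)] at h5
    rw [le_div_iff₀ hε]
    have : ρ + ε = 1 - ε := by rw [hεdef]; ring
    rw [this] at h5
    linarith
  refine ne_top_of_le_ne_top (ENNReal.ofReal_ne_top) (lintegral_le_of_eventually_eq
    (f := fun (K : ℕ) x => min (Y x) K * Y x) (fun K => by fun_prop) ?_ hbound)
  refine Filter.Eventually.of_forall fun x => ?_
  obtain ⟨k, hk⟩ := ENNReal.exists_nat_gt (hYfin x)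
  filter_upwards [Filter.eventually_ge_atTop k] with n hn
  rw [min_eq_left (hk.le.trans (by exact_mod_cast hn)), sq]

end

section

variable {Ω : Type*} [MeasurableSpace Ω] {P : Measure Ω} {N : Ω → Measure ℝ} {η : ℝ} {h : ℝ → ℝ}

/-! ### Square integrable increments and their orthogonality -/

/-- The number of points in `(w, w + Δ]`, as a real number. -/
def count (N : Ω → Measure ℝ) (Δ w : ℝ) (x : Ω) : ℝ := (N x (Ioc w (w + Δ))).toReal

theorem IsStationaryHawkes.count_ne_top (hN : IsStationaryHawkes P N η h) (a b : ℝ) (x : Ω) :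
    N x (Ioc a b) ≠ ∞ :=
  ((hN.pointProcess.counting x).measure_Ioc_lt_top a b).ne

theorem IsStationaryHawkes.integral_count (hN : IsStationaryHawkes P N η h)
    (hs : IsSubcritical η h) [IsProbabilityMeasure P] {a b : ℝ} (hab : a ≤ b) :
    ∫ x, (N x (Ioc a b)).toReal ∂P = rate η h * (b - a) := by
  have h1 := hN.lintegral_count hs (sub_nonneg.2 hab) a
  rw [add_sub_cancel] at h1
  rw [integral_toReal (hN.pointProcess.measurable_coe measurableSet_Ioc).aemeasurable
    (Filter.Eventually.of_forall fun x => (hN.count_ne_top a b x).lt_top), h1,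
    ENNReal.toReal_ofReal (mul_nonneg hs.rate_nonneg (sub_nonneg.2 hab))]

theorem integrable_mul_of_memLp_two {f g : Ω → ℝ} (hf : MemLp f 2 P) (hg : MemLp g 2 P) :
    Integrable (fun x => f x * g x) P :=
  hf.integrable_mul hg

theorem memLp_two_toReal {f : Ω → ℝ≥0∞} (hf : Measurable f) (h2 : ∫⁻ x, f x ^ 2 ∂P ≠ ∞) :
    MemLp (fun x => (f x).toReal) 2 P := by
  rw [memLp_two_iff_integrable_sq hf.ennreal_toReal.aestronglyMeasurable]
  simp_rw [← ENNReal.toReal_pow]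
  exact integrable_toReal_of_lintegral_ne_top (hf.pow_const 2).aemeasurable h2

theorem lintegral_sq_ne_top_of_memLp {f : Ω → ℝ≥0∞} (hfin : ∀ᵐ x ∂P, f x < ∞)
    (h2 : MemLp (fun x => (f x).toReal) 2 P) : ∫⁻ x, f x ^ 2 ∂P ≠ ∞ := by
  have h3 := h2.integrable_sq.lintegral_lt_top
  refine ne_of_lt (lt_of_eq_of_lt (lintegral_congr_ae ?_) h3)
  filter_upwards [hfin] with x hx
  rw [ENNReal.ofReal_pow (by simp), ENNReal.ofReal_toReal hx.ne]

theorem IsStationaryHawkes.memLp_count (hN : IsStationaryHawkes P N η h)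
    (hs : IsSubcritical η h) [IsProbabilityMeasure P] (a b : ℝ) :
    MemLp (fun x => (N x (Ioc a b)).toReal) 2 P := by
  refine memLp_two_toReal (hN.pointProcess.measurable_coe measurableSet_Ioc) ?_
  have h1 := ((hN.identDistrib_count (b - a) a).comp
    (u := fun y : ℝ≥0∞ => y ^ 2) (by fun_prop)).lintegral_eq
  simp only [Function.comp_def, add_sub_cancel] at h1
  rw [h1]
  exact hN.lintegral_count_sq_ne_top hs (b - a)

theorem IsStationaryHawkes.measurable_compensated (hN : IsStationaryHawkes P N η h)
    (hs : IsSubcritical η h) (a b : ℝ) : Measurable (compensated N η h a b) :=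
  (hN.pointProcess.measurable_coe measurableSet_Ioc).ennreal_toReal.sub
    (measurable_compensator_Ioc hN.pointProcess hs.measurable a b).ennreal_toReal

theorem IsStationaryHawkes.memLp_compensated (hN : IsStationaryHawkes P N η h)
    (hs : IsSubcritical η h) [IsProbabilityMeasure P] (a b : ℝ) :
    MemLp (compensated N η h a b) 2 P := by
  rw [memLp_two_iff_integrable_sq (hN.measurable_compensated hs a b).aestronglyMeasurable]
  refine ⟨((hN.measurable_compensated hs a b).pow_const 2).aestronglyMeasurable, ?_⟩
  rw [hasFiniteIntegral_iff_ofReal (Filter.Eventually.of_forall fun x => sq_nonneg _)]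
  exact (hN.lintegral_compensated_sq_le hs.measurable a b).trans_lt
    (hN.lintegral_count_ne_top a b).lt_top

theorem IsStationaryHawkes.memLp_compensator (hN : IsStationaryHawkes P N η h)
    (hs : IsSubcritical η h) [IsProbabilityMeasure P] (a b : ℝ) :
    MemLp (fun x => (compensator N η h x (Ioc a b)).toReal) 2 P := by
  have := (hN.memLp_count hs a b).sub (hN.memLp_compensated hs a b)
  convert this using 2 with x
  simp [compensated]

theorem integral_toReal_mul_toReal {f g : Ω → ℝ≥0∞} (hf : Measurable f) (hg : Measurable g)
    (hff : ∀ᵐ x ∂P, f x < ∞) (hgf : ∀ᵐ x ∂P, g x < ∞) :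
    ∫ x, (f x).toReal * (g x).toReal ∂P = (∫⁻ x, f x * g x ∂P).toReal := by
  simp_rw [← ENNReal.toReal_mul]
  refine integral_toReal (hf.mul hg).aemeasurable ?_
  filter_upwards [hff, hgf] with x h1 h2 using ENNReal.mul_lt_top h1 h2

/-- The compensated increments over intervals to the right of `a` are orthogonal to the history at
time `a`. -/
theorem IsStationaryHawkes.integral_mul_compensated_eq_zero (hN : IsStationaryHawkes P N η h)
    (hs : IsSubcritical η h) [IsProbabilityMeasure P] (a b : ℝ) {f : Ω → ℝ≥0∞}
    (hf : Measurable[history N a] f) (hfin : ∀ᵐ x ∂P, f x < ∞)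
    (h2 : MemLp (fun x => (f x).toReal) 2 P) :
    ∫ x, (f x).toReal * compensated N η h a b x ∂P = 0 := by
  have hpp := hN.pointProcess
  have hf' : Measurable f := hf.mono (history_le hpp a) le_rfl
  have mC : Measurable fun x => compensator N η h x (Ioc a b) :=
    measurable_compensator_Ioc hpp hs.measurable a b
  have key := lintegral_predictable P hpp hs.measurable hN.intensity
    (hN.lintegral_count_ne_top a b) (measurable_predictable_ite hf)
  have hconst : ∀ (μ : Measure ℝ) (x : Ω),
      ∫⁻ t in Ioc a b, (if a < t then f x else 0) ∂μ = f x * μ (Ioc a b) := by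
    intro μ x
    rw [← setLIntegral_const]
    exact setLIntegral_congr_fun measurableSet_Ioc fun t ht => if_pos ht.1
  simp_rw [hconst] at key
  have i1 := integrable_mul_of_memLp_two h2 (hN.memLp_count hs a b)
  have i2 := integrable_mul_of_memLp_two h2 (hN.memLp_compensator hs a b)
  simp only [compensated, mul_sub]
  rw [integral_sub i1 i2, integral_toReal_mul_toReal hf' (hpp.measurable_coe measurableSet_Ioc) hfin
    (Filter.Eventually.of_forall fun x => (hN.count_ne_top a b x).lt_top),
    integral_toReal_mul_toReal hf' mC hfin (hN.ae_compensator_lt_top hs.measurable a b), key,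
    sub_self]

theorem IsStationaryHawkes.integral_compensated (hN : IsStationaryHawkes P N η h)
    (hs : IsSubcritical η h) [IsProbabilityMeasure P] (a b : ℝ) :
    ∫ x, compensated N η h a b x ∂P = 0 := by
  simpa using hN.integral_mul_compensated_eq_zero hs a b (f := fun _ => 1)
    (@measurable_const _ _ _ (history N a) _) (by simp) (by simpa using memLp_const 1)

theorem IsStationaryHawkes.integral_compensated_mul_of_le (hN : IsStationaryHawkes P N η h)
    (hs : IsSubcritical η h) [IsProbabilityMeasure P] {a b c d : ℝ} (hbc : b ≤ c) :
    ∫ x, compensated N η h a b x * compensated N η h c d x ∂P = 0 := by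
  have h1 := hN.integral_mul_compensated_eq_zero hs c d (f := fun x => N x (Ioc a b))
    (measurable_history_coe N measurableSet_Ioc fun t ht => ht.2.trans hbc)
    (Filter.Eventually.of_forall fun x => (hN.count_ne_top a b x).lt_top) (hN.memLp_count hs a b)
  have h2 := hN.integral_mul_compensated_eq_zero hs c d
    (f := fun x => compensator N η h x (Ioc a b))
    ((measurable_history_compensator hN.pointProcess η hs.measurable a b).mono
      (history_mono N hbc) le_rfl)
    (hN.ae_compensator_lt_top hs.measurable a b) (hN.memLp_compensator hs a b)
  have i1 := integrable_mul_of_memLp_two (hN.memLp_count hs a b) (hN.memLp_compensated hs c d)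
  have i2 := integrable_mul_of_memLp_two (hN.memLp_compensator hs a b) (hN.memLp_compensated hs c d)
  have : ∀ x, compensated N η h a b x * compensated N η h c d x =
      (N x (Ioc a b)).toReal * compensated N η h c d x -
        (compensator N η h x (Ioc a b)).toReal * compensated N η h c d x := fun x => by
    rw [← sub_mul]; rfl
  simp_rw [this]
  rw [integral_sub i1 i2, h1, h2, sub_self]

/-- The variance identity without localization, all of whose terms are now known to be finite. -/
theorem IsStationaryHawkes.integral_compensated_sq (hN : IsStationaryHawkes P N η h)
    (hs : IsSubcritical η h) [IsProbabilityMeasure P] {a b : ℝ} (hab : a ≤ b) :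
    ∫ x, compensated N η h a b x * compensated N η h a b x ∂P = rate η h * (b - a) := by
  have hpp := hN.pointProcess
  have mA : Measurable fun x => N x (Ioc a b) := hpp.measurable_coe measurableSet_Ioc
  have mC : Measurable fun x => compensator N η h x (Ioc a b) :=
    measurable_compensator_Ioc hpp hs.measurable a b
  have fA : ∀ᵐ x ∂P, N x (Ioc a b) < ∞ :=
    Filter.Eventually.of_forall fun x => (hN.count_ne_top a b x).lt_top
  have fC := hN.ae_compensator_lt_top hs.measurable a b
  have hid := hN.lintegral_sq_add_sq hs.measurable a b ∞
  have hD : ∀ x, localizedIoc N η h a b ∞ x = Ioc a b := fun x => localizedIoc_eq_Ioc le_top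
  simp_rw [hD] at hid
  have e1 := lintegral_sq_ne_top_of_memLp fA (hN.memLp_count hs a b)
  have e2 := lintegral_sq_ne_top_of_memLp fC (hN.memLp_compensator hs a b)
  have e3 : ∫⁻ x, N x (Ioc a b) ∂P + 2 * ∫⁻ x, N x (Ioc a b) * compensator N η h x (Ioc a b) ∂P
      ≠ ∞ := by
    rw [← hid]; finiteness
  have e4 := hN.lintegral_count_ne_top a b
  have e5 : ∫⁻ x, N x (Ioc a b) * compensator N η h x (Ioc a b) ∂P ≠ ∞ := by
    intro h0
    rw [h0] at e3
    simp at e3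
  have h0 := congrArg ENNReal.toReal hid
  rw [ENNReal.toReal_add e1 e2, ENNReal.toReal_add e4 (by finiteness), ENNReal.toReal_mul] at h0
  simp_rw [sq] at h0
  rw [← integral_toReal_mul_toReal mA mA fA fA, ← integral_toReal_mul_toReal mC mC fC fC,
    ← integral_toReal_mul_toReal mA mC fA fC, ← integral_toReal mA.aemeasurable fA,
    hN.integral_count hs hab] at h0
  have iA := (hN.memLp_count hs a b)
  have iC := (hN.memLp_compensator hs a b)
  have hexp : ∀ x, compensated N η h a b x * compensated N η h a b x =
      ((N x (Ioc a b)).toReal * (N x (Ioc a b)).toReal +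
        (compensator N η h x (Ioc a b)).toReal * (compensator N η h x (Ioc a b)).toReal) -
        2 * ((N x (Ioc a b)).toReal * (compensator N η h x (Ioc a b)).toReal) := fun x => by
    simp only [compensated]; ring
  simp_rw [hexp]
  have j1 := integrable_mul_of_memLp_two iA iA
  have j2 := integrable_mul_of_memLp_two iC iC
  have j3 := integrable_mul_of_memLp_two iA iC
  rw [integral_sub (by exact j1.add j2) (j3.const_mul 2), integral_add j1 j2, integral_const_mul]
  simp only [ENNReal.toReal_ofNat] at h0
  linarith

theorem IsStationaryHawkes.ae_compensated_add (hN : IsStationaryHawkes P N η h)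
    (hs : IsSubcritical η h) {a b c : ℝ} (hab : a ≤ b) (hbc : b ≤ c) :
    ∀ᵐ x ∂P, compensated N η h a c x = compensated N η h a b x + compensated N η h b c x := by
  filter_upwards [hN.ae_compensator_lt_top hs.measurable a b,
    hN.ae_compensator_lt_top hs.measurable b c] with x h1 h2
  have hadd : ∀ μ : Measure ℝ, μ (Ioc a c) = μ (Ioc a b) + μ (Ioc b c) := fun μ => by
    rw [← measure_union (Ioc_disjoint_Ioc_of_le le_rfl) measurableSet_Ioc,
      Ioc_union_Ioc_eq_Ioc hab hbc]
  simp only [compensated, hadd]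
  rw [ENNReal.toReal_add (hN.count_ne_top _ _ _) (hN.count_ne_top _ _ _),
    ENNReal.toReal_add h1.ne h2.ne]
  ring

/-- Two overlapping compensated increments are correlated through the overlap. -/
theorem IsStationaryHawkes.integral_compensated_mul_of_overlap (hN : IsStationaryHawkes P N η h)
    (hs : IsSubcritical η h) [IsProbabilityMeasure P] {a b c d : ℝ} (hab : a ≤ b) (hbc : b ≤ c)
    (hcd : c ≤ d) :
    ∫ x, compensated N η h a c x * compensated N η h b d x ∂P = rate η h * (c - b) := by
  have L := fun u v => hN.memLp_compensated hs (P := P) u v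
  have hexp : ∫ x, compensated N η h a c x * compensated N η h b d x ∂P =
      ∫ x, (compensated N η h a b x * compensated N η h b d x +
        (compensated N η h b c x * compensated N η h b c x +
          compensated N η h b c x * compensated N η h c d x)) ∂P := by
    refine integral_congr_ae ?_
    filter_upwards [hN.ae_compensated_add hs hab hbc, hN.ae_compensated_add hs hbc hcd]
      with x h1 h2
    rw [h1, h2]; ring
  have j1 := integrable_mul_of_memLp_two (L a b) (L b d)
  have j2 := integrable_mul_of_memLp_two (L b c) (L b c)
  have j3 := integrable_mul_of_memLp_two (L b c) (L c d)
  rw [hexp, integral_add j1 (by exact j2.add j3), integral_add j2 j3,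
    hN.integral_compensated_mul_of_le hs le_rfl, hN.integral_compensated_mul_of_le hs le_rfl,
    hN.integral_compensated_sq hs hbc]
  ring

/-- The compensated process has the second order structure of white noise with intensity the mean
rate. -/
theorem IsStationaryHawkes.integral_compensated_mul (hN : IsStationaryHawkes P N η h)
    (hs : IsSubcritical η h) [IsProbabilityMeasure P] (Δ w : ℝ) :
    ∫ x, compensated N η h 0 (0 + Δ) x * compensated N η h w (w + Δ) x ∂P =
      rate η h * volume.real (Ioc 0 (0 + Δ) ∩ Ioc w (w + Δ)) := by
  rw [Ioc_inter_Ioc, Real.volume_real_Ioc, zero_add]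
  rcases le_total 0 w with hw | hw
  · rw [max_eq_right hw, min_eq_left (by linarith)]
    rcases le_total w Δ with h1 | h1
    · rw [max_eq_left (by linarith),
        hN.integral_compensated_mul_of_overlap hs hw h1 (by linarith)]
    · rw [max_eq_right (by linarith), hN.integral_compensated_mul_of_le hs h1, mul_zero]
  · rw [max_eq_left hw, min_eq_right (by linarith)]
    simp_rw [mul_comm (compensated N η h 0 Δ _)]
    rcases le_total (-w) Δ with h1 | h1
    · rw [max_eq_left (by linarith),
        hN.integral_compensated_mul_of_overlap hs hw (by linarith) (by linarith)]
    · rw [max_eq_right (by linarith), hN.integral_compensated_mul_of_le hs (by linarith), mul_zero]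

end

section

variable {Ω : Type*} [MeasurableSpace Ω] {P : Measure Ω} {N : Ω → Measure ℝ} {η : ℝ} {h : ℝ → ℝ}

/-! ### Renewal equations for the correlations -/

/-- The correlation `E[Z N(w, w + Δ]]` of a random variable with the sliding count. -/
def corr (P : Measure Ω) (N : Ω → Measure ℝ) (Δ : ℝ) (Z : Ω → ℝ) (w : ℝ) : ℝ :=
  ∫ x, Z x * count N Δ w x ∂P

/-- Replacing the count by its compensator turns a correlation into a mixture of correlations at
earlier times. -/
theorem IsStationaryHawkes.integral_mul_compensator (hN : IsStationaryHawkes P N η h)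
    (hs : IsSubcritical η h) [IsProbabilityMeasure P] {Δ : ℝ} (hΔ : 0 ≤ Δ) (w : ℝ)
    {f : Ω → ℝ≥0∞} (hf : Measurable f) (hfin : ∀ᵐ x ∂P, f x < ∞)
    (h2 : MemLp (fun x => (f x).toReal) 2 P) :
    Integrable (fun v => h v * corr P N Δ (fun x => (f x).toReal) (w - v)) ∧
      ∫ x, (f x).toReal * (compensator N η h x (Ioc w (w + Δ))).toReal ∂P =
        η * Δ * ∫ x, (f x).toReal ∂P +
          ∫ v, h v * corr P N Δ (fun x => (f x).toReal) (w - v) := by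
  have hpp := hN.pointProcess
  have mC : Measurable fun x => compensator N η h x (Ioc w (w + Δ)) :=
    measurable_compensator_Ioc hpp hs.measurable _ _
  have fC := hN.ae_compensator_lt_top hs.measurable w (w + Δ)
  have key := lintegral_mul_compensator (P := P) hpp hs.immigration_nonneg hs.measurable
    hs.eq_zero_of_neg Δ w hf
  have hfinite : ∫⁻ x, f x * compensator N η h x (Ioc w (w + Δ)) ∂P ≠ ∞ := by
    have h3 := (integrable_mul_of_memLp_two h2
      (hN.memLp_compensator hs w (w + Δ))).lintegral_lt_top
    refine ne_of_lt (lt_of_eq_of_lt (lintegral_congr_ae ?_) h3)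
    filter_upwards [hfin, fC] with x h4 h5
    rw [ENNReal.ofReal_mul (by simp), ENNReal.ofReal_toReal h4.ne, ENNReal.ofReal_toReal h5.ne]
  have hfinite' := hfinite
  rw [key] at hfinite'
  have hR := (ENNReal.add_ne_top.1 hfinite').2
  have hL := (ENNReal.add_ne_top.1 hfinite').1
  have hm : Measurable fun v => ENNReal.ofReal (h v) *
      ∫⁻ x, f x * N x (Ioc (w - v) (w - v + Δ)) ∂P := by
    refine hs.measurable.ennreal_ofReal.mul ?_
    have h1 : Measurable fun p : Ω × ℝ => f p.1 * N p.1 (Ioc (w - p.2) (w - p.2 + Δ)) :=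
      (hf.comp measurable_fst).mul ((measurable_count_Ioc hpp Δ).comp
        (measurable_fst.prodMk (measurable_const.sub measurable_snd)))
    exact h1.lintegral_prod_left'
  have hcorr : ∀ v, h v * corr P N Δ (fun x => (f x).toReal) (w - v) =
      (ENNReal.ofReal (h v) * ∫⁻ x, f x * N x (Ioc (w - v) (w - v + Δ)) ∂P).toReal := fun v => by
    rw [ENNReal.toReal_mul, ENNReal.toReal_ofReal (hs.nonneg v),
      ← integral_toReal_mul_toReal hf (hpp.measurable_coe measurableSet_Ioc) hfin
      (Filter.Eventually.of_forall fun x => (hN.count_ne_top _ _ x).lt_top)]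
    rfl
  simp_rw [hcorr]
  refine ⟨integrable_toReal_of_lintegral_ne_top hm.aemeasurable hR, ?_⟩
  rw [integral_toReal_mul_toReal hf mC hfin fC, key, ENNReal.toReal_add hL hR, ENNReal.toReal_mul,
    ENNReal.toReal_ofReal (mul_nonneg hs.immigration_nonneg hΔ), integral_toReal hf.aemeasurable hfin,
    integral_toReal hm.aemeasurable (ae_lt_top hm hR)]

theorem IsStationaryHawkes.memLp_count' (hN : IsStationaryHawkes P N η h)
    (hs : IsSubcritical η h) [IsProbabilityMeasure P] (Δ w : ℝ) : MemLp (count N Δ w) 2 P :=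
  hN.memLp_count hs w (w + Δ)

/-- The renewal equation for the correlation of the counts with a compensated increment. -/
theorem IsStationaryHawkes.corr_compensated_eq (hN : IsStationaryHawkes P N η h)
    (hs : IsSubcritical η h) [IsProbabilityMeasure P] {Δ : ℝ} (hΔ : 0 ≤ Δ) (w : ℝ) :
    corr P N Δ (compensated N η h 0 (0 + Δ)) w =
      (∫ v, h v * corr P N Δ (compensated N η h 0 (0 + Δ)) (w - v)) +
        rate η h * volume.real (Ioc 0 (0 + Δ) ∩ Ioc w (w + Δ)) := by
  have hpp := hN.pointProcess
  set M := compensated N η h 0 (0 + Δ)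
  have fA : ∀ᵐ x ∂P, N x (Ioc 0 (0 + Δ)) < ∞ :=
    Filter.Eventually.of_forall fun x => (hN.count_ne_top _ _ x).lt_top
  have fC := hN.ae_compensator_lt_top hs.measurable 0 (0 + Δ)
  have lA := hN.memLp_count hs 0 (0 + Δ)
  have lC := hN.memLp_compensator hs 0 (0 + Δ)
  obtain ⟨i1, e1⟩ := hN.integral_mul_compensator hs hΔ w
    (f := fun x => N x (Ioc 0 (0 + Δ))) (hpp.measurable_coe measurableSet_Ioc) fA lA
  obtain ⟨i2, e2⟩ := hN.integral_mul_compensator hs hΔ w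
    (f := fun x => compensator N η h x (Ioc 0 (0 + Δ)))
    (measurable_compensator_Ioc hpp hs.measurable _ _) fC lC
  have hcorr : ∀ u, corr P N Δ M u = corr P N Δ (fun x => (N x (Ioc 0 (0 + Δ))).toReal) u -
      corr P N Δ (fun x => (compensator N η h x (Ioc 0 (0 + Δ))).toReal) u := fun u => by
    have l := hN.memLp_count' hs Δ u
    unfold corr
    rw [← integral_sub (integrable_mul_of_memLp_two lA l) (integrable_mul_of_memLp_two lC l)]
    refine integral_congr_ae (Filter.Eventually.of_forall fun x => ?_)
    simp only [M, compensated]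
    ring
  have hM0 : ∫ x, (N x (Ioc 0 (0 + Δ))).toReal ∂P =
      ∫ x, (compensator N η h x (Ioc 0 (0 + Δ))).toReal ∂P := by
    have := hN.integral_compensated hs 0 (0 + Δ)
    unfold compensated at this
    rwa [integral_sub (lA.integrable one_le_two) (lC.integrable one_le_two), sub_eq_zero] at this
  have lM := hN.memLp_compensated hs 0 (0 + Δ)
  have lMw := hN.memLp_compensated hs w (w + Δ)
  have lCw := hN.memLp_compensator hs w (w + Δ)
  have hsplit : corr P N Δ M w =
      ∫ x, M x * (compensator N η h x (Ioc w (w + Δ))).toReal ∂P +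
        ∫ x, M x * compensated N η h w (w + Δ) x ∂P := by
    rw [← integral_add (integrable_mul_of_memLp_two lM lCw) (integrable_mul_of_memLp_two lM lMw)]
    refine integral_congr_ae (Filter.Eventually.of_forall fun x => ?_)
    simp only [M, compensated, count]
    ring
  have hMC : ∫ x, M x * (compensator N η h x (Ioc w (w + Δ))).toReal ∂P =
      ∫ x, (N x (Ioc 0 (0 + Δ))).toReal * (compensator N η h x (Ioc w (w + Δ))).toReal ∂P -
      ∫ x, (compensator N η h x (Ioc 0 (0 + Δ))).toReal *
        (compensator N η h x (Ioc w (w + Δ))).toReal ∂P := by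
    rw [← integral_sub (integrable_mul_of_memLp_two lA lCw) (integrable_mul_of_memLp_two lC lCw)]
    refine integral_congr_ae (Filter.Eventually.of_forall fun x => ?_)
    simp only [M, compensated]
    ring
  rw [hsplit, hN.integral_compensated_mul hs, hMC, e1, e2, hM0]
  simp_rw [hcorr, mul_sub]
  rw [integral_sub i1 i2]
  ring

/-- Second order stationarity of the counts. -/
theorem IsStationaryHawkes.corr_count_shift (hN : IsStationaryHawkes P N η h) (Δ s t r : ℝ) :
    corr P N Δ (count N Δ (s + r)) (t + r) = corr P N Δ (count N Δ s) t :=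
  ((hN.identDistrib_pair Δ s t r).comp
    (u := fun p : ℝ≥0∞ × ℝ≥0∞ => p.1.toReal * p.2.toReal) (by fun_prop)).integral_eq

/-- The autocovariance of the sliding counts at lag `w`. -/
def slidingCov (P : Measure Ω) (N : Ω → Measure ℝ) (η : ℝ) (h : ℝ → ℝ) (Δ w : ℝ) : ℝ :=
  corr P N Δ (count N Δ 0) w - (rate η h * Δ) ^ 2

theorem IsStationaryHawkes.integral_count' (hN : IsStationaryHawkes P N η h)
    (hs : IsSubcritical η h) [IsProbabilityMeasure P] {Δ : ℝ} (hΔ : 0 ≤ Δ) (w : ℝ) :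
    ∫ x, count N Δ w x ∂P = rate η h * Δ := by
  have := hN.integral_count hs (show w ≤ w + Δ by linarith)
  rwa [add_sub_cancel_left] at this

theorem IsStationaryHawkes.covariance_count (hN : IsStationaryHawkes P N η h)
    (hs : IsSubcritical η h) [IsProbabilityMeasure P] {Δ : ℝ} (hΔ : 0 ≤ Δ) (s w : ℝ) :
    covariance (count N Δ s) (count N Δ (s + w)) P = slidingCov P N η h Δ w := by
  rw [covariance_eq_sub (hN.memLp_count' hs Δ s) (hN.memLp_count' hs Δ (s + w)),
    hN.integral_count' hs hΔ, hN.integral_count' hs hΔ, slidingCov,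
    ← hN.corr_count_shift Δ 0 w s, zero_add, add_comm w s, sq]
  rfl

/-- The time-reversed renewal equation, which leads from the correlation with a compensated
increment to the autocovariance. -/
theorem IsStationaryHawkes.slidingCov_eq (hN : IsStationaryHawkes P N η h)
    (hs : IsSubcritical η h) [IsProbabilityMeasure P] {Δ : ℝ} (hΔ : 0 ≤ Δ) (w : ℝ) :
    slidingCov P N η h Δ w = (∫ v, h v * slidingCov P N η h Δ (w + v)) +
      corr P N Δ (compensated N η h 0 (0 + Δ)) w := by
  have hpp := hN.pointProcess
  have lw := hN.memLp_count' hs Δ w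
  have lC := hN.memLp_compensator hs 0 (0 + Δ)
  have lM := hN.memLp_compensated hs 0 (0 + Δ)
  obtain ⟨i1, e1⟩ := hN.integral_mul_compensator hs hΔ 0
    (f := fun x => N x (Ioc w (w + Δ))) (hpp.measurable_coe measurableSet_Ioc)
    (Filter.Eventually.of_forall fun x => (hN.count_ne_top _ _ x).lt_top) lw
  -- a shift by `v` turns the correlation of lag `-v` behind `w` into an autocovariance
  have hshift : ∀ v, corr P N Δ (fun x => (N x (Ioc w (w + Δ))).toReal) (0 - v) =
      slidingCov P N η h Δ (w + v) + (rate η h * Δ) ^ 2 := fun v => by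
    have h1 := hN.corr_count_shift Δ 0 (w + v) (-v)
    rw [slidingCov, sub_add_cancel, ← h1, add_neg_cancel_right]
    unfold corr
    refine integral_congr_ae (Filter.Eventually.of_forall fun x => ?_)
    simp only [count, zero_sub, zero_add]
    ring
  have hsplit : corr P N Δ (count N Δ 0) w =
      ∫ x, (N x (Ioc w (w + Δ))).toReal * (compensator N η h x (Ioc 0 (0 + Δ))).toReal ∂P +
        corr P N Δ (compensated N η h 0 (0 + Δ)) w := by
    unfold corr
    refine Eq.trans ?_ (integral_add (integrable_mul_of_memLp_two lw lC)
      (integrable_mul_of_memLp_two lM lw))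
    refine integral_congr_ae (Filter.Eventually.of_forall fun x => ?_)
    simp only [compensated, count]
    ring
  simp_rw [hshift, mul_add] at i1 e1
  have i2 : Integrable fun v => h v * (rate η h * Δ) ^ 2 := hs.integrable.mul_const _
  have i3 : Integrable fun v => h v * slidingCov P N η h Δ (w + v) := by
    simpa [Pi.sub_def] using i1.sub i2
  have hmean : ∫ x, (N x (Ioc w (w + Δ))).toReal ∂P = rate η h * Δ := hN.integral_count' hs hΔ w
  rw [slidingCov, hsplit, e1, hmean, integral_add i3 i2, integral_mul_const]
  have := hs.rate_eq
  have h5 : η * Δ * (rate η h * Δ) + (∫ t, h t) * (rate η h * Δ) ^ 2 = (rate η h * Δ) ^ 2 := by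
    calc _ = (η + (∫ t, h t) * rate η h) * Δ * (rate η h * Δ) := by ring
      _ = _ := by rw [this]; ring
  linarith

theorem IsStationaryHawkes.ae_measure_singleton_eq_zero (hN : IsStationaryHawkes P N η h)
    (hs : IsSubcritical η h) [IsProbabilityMeasure P] (t : ℝ) : ∀ᵐ x ∂P, N x {t} = 0 := by
  have m := hN.pointProcess.measurable_coe (measurableSet_singleton t)
  refine (lintegral_eq_zero_iff m).1 (le_antisymm ?_ zero_le)
  have hle : ∀ n : ℕ, ∫⁻ x, N x {t} ∂P ≤ ENNReal.ofReal (rate η h * (1 / (n + 1))) := fun n => by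
    have hε : (0 : ℝ) < 1 / (n + 1) := by positivity
    rw [← hN.lintegral_count hs hε.le (t - 1 / (n + 1))]
    refine lintegral_mono fun x => measure_mono ?_
    simp only [singleton_subset_iff, mem_Ioc]
    constructor <;> linarith
  have hlim : Filter.Tendsto (fun n : ℕ => ENNReal.ofReal (rate η h * (1 / (n + 1)))) Filter.atTop
      (nhds (ENNReal.ofReal (rate η h * 0))) :=
    ENNReal.tendsto_ofReal (tendsto_one_div_add_atTop_nhds_zero_nat.const_mul _)
  rw [mul_zero, ENNReal.ofReal_zero] at hlim
  exact ge_of_tendsto' hlim hle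

/-- Correlations with the sliding count are continuous, since a fixed time is almost surely not a
point of the process. -/
theorem IsStationaryHawkes.continuous_corr (hN : IsStationaryHawkes P N η h)
    (hs : IsSubcritical η h) [IsProbabilityMeasure P] (Δ : ℝ) {Z : Ω → ℝ} (hZ : MemLp Z 2 P) :
    Continuous (corr P N Δ Z) := by
  rw [continuous_iff_continuousAt]
  intro w₀
  have hB := hN.memLp_count hs (w₀ - 1) (w₀ + 1 + Δ)
  have hnhds : ∀ᶠ w in nhds w₀, w ∈ Ioo (w₀ - 1) (w₀ + 1) := Ioo_mem_nhds (by linarith) (by linarith)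
  have hsub : ∀ w ∈ Ioo (w₀ - 1) (w₀ + 1), Ioc w (w + Δ) ⊆ Ioc (w₀ - 1) (w₀ + 1 + Δ) :=
    fun w hw => Ioc_subset_Ioc hw.1.le (by linarith [hw.2])
  refine continuousAt_of_dominated
    (bound := fun x => |Z x| * (N x (Ioc (w₀ - 1) (w₀ + 1 + Δ))).toReal) ?_ ?_ ?_ ?_
  · exact Filter.Eventually.of_forall fun w =>
      (integrable_mul_of_memLp_two hZ (hN.memLp_count' hs Δ w)).aestronglyMeasurable
  · filter_upwards [hnhds] with w hw
    refine Filter.Eventually.of_forall fun x => ?_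
    rw [norm_mul, Real.norm_eq_abs, Real.norm_eq_abs, count, abs_of_nonneg ENNReal.toReal_nonneg]
    exact mul_le_mul_of_nonneg_left (ENNReal.toReal_mono (hN.count_ne_top _ _ x)
      (measure_mono (hsub w hw))) (abs_nonneg _)
  · exact integrable_mul_of_memLp_two hZ.abs hB
  · filter_upwards [hN.ae_measure_singleton_eq_zero hs w₀,
      hN.ae_measure_singleton_eq_zero hs (w₀ + Δ)] with x h1 h2
    refine ContinuousAt.mul continuousAt_const ?_
    refine (ENNReal.tendsto_toReal (hN.count_ne_top _ _ x)).comp ?_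
    refine tendsto_measure_of_ae_tendsto_indicator _ measurableSet_Ioc (fun _ => measurableSet_Ioc)
      (measurableSet_Ioc (a := w₀ - 1) (b := w₀ + 1 + Δ)) (hN.count_ne_top _ _ x)
      (hnhds.mono hsub) ?_
    have h3 : ∀ᵐ t ∂(N x), t ≠ w₀ := by
      rw [ae_iff]; simpa using h1
    have h4 : ∀ᵐ t ∂(N x), t ≠ w₀ + Δ := by
      rw [ae_iff]; simpa using h2
    filter_upwards [h3, h4] with t ht1 ht2
    have c1 : ∀ᶠ w in nhds w₀, (w < t ↔ w₀ < t) := by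
      rcases lt_or_gt_of_ne ht1 with h | h
      · filter_upwards [lt_mem_nhds h] with w hw
        exact ⟨fun h' => absurd h' hw.not_gt, fun h' => absurd h' h.not_gt⟩
      · filter_upwards [gt_mem_nhds h] with w hw using ⟨fun _ => h, fun _ => hw⟩
    have c2 : ∀ᶠ w in nhds w₀, (t ≤ w + Δ ↔ t ≤ w₀ + Δ) := by
      rcases lt_or_gt_of_ne ht2 with h | h
      · filter_upwards [lt_mem_nhds (show t - Δ < w₀ by linarith)] with w hw
        exact ⟨fun _ => h.le, fun _ => by linarith⟩
      · filter_upwards [gt_mem_nhds (show w₀ < t - Δ by linarith)] with w hw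
        exact ⟨fun h' => by linarith, fun h' => absurd h' (not_le.2 h)⟩
    filter_upwards [c1, c2] with w hw1 hw2
    rw [mem_Ioc, mem_Ioc, hw1, hw2]

theorem IsStationaryHawkes.exists_forall_abs_corr_le (hN : IsStationaryHawkes P N η h)
    (hs : IsSubcritical η h) [IsProbabilityMeasure P] (Δ : ℝ) {Z : Ω → ℝ} (hZ : MemLp Z 2 P) :
    ∃ B, ∀ w, |corr P N Δ Z w| ≤ B := by
  refine ⟨∫ x, Z x ^ 2 ∂P + ∫ x, count N Δ 0 x ^ 2 ∂P, fun w => ?_⟩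
  have h1 : ∫ x, count N Δ w x ^ 2 ∂P = ∫ x, count N Δ 0 x ^ 2 ∂P :=
    ((hN.identDistrib_count Δ w).comp (u := fun y : ℝ≥0∞ => y.toReal ^ 2) (by fun_prop)).integral_eq
  have lw := hN.memLp_count' hs Δ w
  rw [← h1, ← integral_add hZ.integrable_sq lw.integrable_sq]
  refine abs_integral_le_integral_abs.trans ?_
  refine integral_mono (integrable_mul_of_memLp_two hZ lw).abs
    (hZ.integrable_sq.add lw.integrable_sq) fun x => ?_
  rw [abs_mul]
  have := two_mul_le_add_sq |Z x| |count N Δ w x|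
  rw [sq_abs, sq_abs] at this
  have h3 : 0 ≤ |Z x| * |count N Δ w x| := by positivity
  show _ ≤ Z x ^ 2 + count N Δ w x ^ 2
  linarith

end

section

/-! ### Renewal equations and Fourier transforms on the line -/

section Fourier

open FourierTransform

theorem fourierT_eq (φ : ℝ → ℝ) (ω : ℝ) :
    fourierT φ ω = 𝓕 (fun s => (φ s : ℂ)) (ω / (2 * Real.pi)) := by
  rw [Real.fourier_real_eq_integral_exp_smul, fourierT]
  refine integral_congr_ae (Filter.Eventually.of_forall fun s => ?_)
  have hπ : (Real.pi : ℂ) ≠ 0 := by exact_mod_cast Real.pi_ne_zero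
  simp only [smul_eq_mul]
  rw [mul_comm]
  congr 2
  push_cast
  field_simp

theorem continuous_fourierT {φ : ℝ → ℝ} (hφ : Integrable φ) : Continuous (fourierT φ) := by
  have h1 : Continuous (𝓕 fun s => (φ s : ℂ)) :=
    VectorFourier.fourierIntegral_continuous Real.continuous_fourierChar
      (by exact continuous_inner) hφ.ofReal
  have h2 : fourierT φ = fun ω => 𝓕 (fun s => (φ s : ℂ)) (ω / (2 * Real.pi)) :=
    funext (fourierT_eq φ)
  rw [h2]
  exact h1.comp (by fun_prop)

theorem norm_mul_exp_eq (c ω s : ℝ) :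
    ‖(c : ℂ) * Complex.exp (-(Complex.I * (ω : ℂ) * (s : ℂ)))‖ = |c| := by
  have : -(Complex.I * (ω : ℂ) * (s : ℂ)) = ((-(ω * s) : ℝ) : ℂ) * Complex.I := by
    push_cast; ring
  rw [norm_mul, this, Complex.norm_exp_ofReal_mul_I, mul_one, Complex.norm_real, Real.norm_eq_abs]

theorem integrable_mul_exp {φ : ℝ → ℝ} (hφ : Integrable φ) (ω : ℝ) :
    Integrable fun s => (φ s : ℂ) * Complex.exp (-(Complex.I * (ω : ℂ) * (s : ℂ))) := by
  refine hφ.mono ?_ (Filter.Eventually.of_forall fun s => (norm_mul_exp_eq _ _ _).le)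
  exact (hφ.ofReal (𝕜 := ℂ)).aestronglyMeasurable.mul
    (Continuous.aestronglyMeasurable (by fun_prop))

theorem norm_fourierT_le (φ : ℝ → ℝ) (ω : ℝ) : ‖fourierT φ ω‖ ≤ ∫ s, |φ s| := by
  refine (norm_integral_le_integral_norm _).trans (le_of_eq ?_)
  simp_rw [norm_mul_exp_eq]

theorem ofReal_conv_eq_convolution (k f : ℝ → ℝ) :
    (fun w => ((∫ v, k v * f (w - v) : ℝ) : ℂ)) =
      convolution (fun s => (k s : ℂ)) (fun s => (f s : ℂ)) (ContinuousLinearMap.mul ℂ ℂ)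
        volume := by
  ext w
  rw [convolution_def, ← integral_complex_ofReal]
  refine integral_congr_ae (Filter.Eventually.of_forall fun v => ?_)
  simp

theorem fourierT_conv {k f : ℝ → ℝ} (hk : Integrable k) (hf : Integrable f) (ω : ℝ) :
    fourierT (fun w => ∫ v, k v * f (w - v)) ω = fourierT k ω * fourierT f ω := by
  rw [fourierT_eq, fourierT_eq, fourierT_eq, ofReal_conv_eq_convolution]
  exact Real.fourier_mul_convolution_eq hk.ofReal hf.ofReal _

theorem integrable_conv {k f : ℝ → ℝ} (hk : Integrable k) (hf : Integrable f) :
    Integrable fun w => ∫ v, k v * f (w - v) := by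
  have := hk.integrable_convolution (ContinuousLinearMap.mul ℝ ℝ) hf
  refine this.congr (Filter.Eventually.of_forall fun w => ?_)
  simp [convolution_def]

theorem fourierT_neg (k : ℝ → ℝ) (ω : ℝ) :
    fourierT (fun s => k (-s)) ω = (starRingEnd ℂ) (fourierT k ω) := by
  unfold fourierT
  rw [← integral_conj, ← integral_neg_eq_self]
  refine integral_congr_ae (Filter.Eventually.of_forall fun s => ?_)
  simp only [neg_neg, map_mul, Complex.conj_ofReal, ← Complex.exp_conj, map_neg, Complex.conj_I]
  congr 2
  push_cast
  ring

theorem fourierT_add {f g : ℝ → ℝ} (hf : Integrable f) (hg : Integrable g) (ω : ℝ) :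
    fourierT (fun s => f s + g s) ω = fourierT f ω + fourierT g ω := by
  unfold fourierT
  rw [← integral_add (integrable_mul_exp hf ω) (integrable_mul_exp hg ω)]
  refine integral_congr_ae (Filter.Eventually.of_forall fun s => ?_)
  push_cast
  ring

theorem fourierT_const_mul (c : ℝ) (f : ℝ → ℝ) (ω : ℝ) :
    fourierT (fun s => c * f s) ω = c * fourierT f ω := by
  unfold fourierT
  rw [← integral_const_mul]
  refine integral_congr_ae (Filter.Eventually.of_forall fun s => ?_)
  push_cast
  ring

theorem fourierT_comp_mul {c : ℝ} (hc : 0 < c) (f : ℝ → ℝ) (ω : ℝ) :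
    fourierT (fun s => f (s * c)) ω = (c : ℂ)⁻¹ * fourierT f (ω / c) := by
  unfold fourierT
  have hc' : (c : ℂ) ≠ 0 := by exact_mod_cast hc.ne'
  have h1 := Measure.integral_comp_mul_left
    (fun s : ℝ => (f s : ℂ) * Complex.exp (-(Complex.I * ((ω / c : ℝ) : ℂ) * (s : ℂ)))) c
  rw [abs_of_pos (inv_pos.2 hc), Complex.real_smul, Complex.ofReal_inv] at h1
  rw [← h1]
  refine integral_congr_ae (Filter.Eventually.of_forall fun s => ?_)
  simp only
  rw [mul_comm s c]
  congr 3
  push_cast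
  field_simp

/-- Fourier inversion in the normalization of `fourierT`. -/
theorem fourierT_inversion {r : ℝ → ℝ} (hr : Integrable r) (hc : Continuous r)
    (hf : Integrable (fourierT r)) (u : ℝ) :
    (r u : ℂ) = 1 / (2 * (Real.pi : ℂ)) *
      ∫ ω : ℝ, fourierT r ω * Complex.exp (Complex.I * (ω : ℂ) * (u : ℂ)) := by
  have hπ : 0 < 2 * Real.pi := by positivity
  have h𝓕 : ∀ v, 𝓕 (fun s => (r s : ℂ)) v = fourierT r (2 * Real.pi * v) := fun v => by
    rw [fourierT_eq, mul_div_cancel_left₀ _ hπ.ne']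
  have hint : Integrable (𝓕 fun s => (r s : ℂ)) := by
    have h0 : (𝓕 fun s => (r s : ℂ)) = fun v => fourierT r (2 * Real.pi * v) := funext h𝓕
    rw [h0]
    exact hf.comp_mul_left' hπ.ne'
  have h1 := (hr.ofReal (𝕜 := ℂ)).fourierInv_fourier_eq hint
    (v := u) (Complex.continuous_ofReal.comp hc).continuousAt
  rw [Real.fourierInv_eq'] at h1
  have h2 := Measure.integral_comp_mul_left
    (fun ω : ℝ => fourierT r ω * Complex.exp (Complex.I * (ω : ℂ) * (u : ℂ))) (2 * Real.pi)
  rw [abs_of_pos (inv_pos.2 hπ), Complex.real_smul] at h2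
  have h3 : (1 / (2 * (Real.pi : ℂ))) = (((2 * Real.pi)⁻¹ : ℝ) : ℂ) := by push_cast; simp
  rw [h3, ← h2]
  refine Eq.trans h1.symm ?_
  refine integral_congr_ae (Filter.Eventually.of_forall fun v => ?_)
  change Complex.exp (((2 * Real.pi * inner ℝ v u : ℝ) : ℂ) * Complex.I) •
    𝓕 (fun s => (r s : ℂ)) v = _
  rw [h𝓕, smul_eq_mul, mul_comm, RCLike.inner_apply, conj_trivial]
  congr 2
  push_cast
  ring

/-- The overlap of a bin with its translate is the autocorrelation of the indicator of the bin. -/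
theorem integral_indicator_mul_indicator (Δ w : ℝ) :
    volume.real (Ioc 0 (0 + Δ) ∩ Ioc w (w + Δ)) =
      ∫ v, (Ioc 0 Δ).indicator 1 v * (fun s => (Ioc 0 Δ).indicator (1 : ℝ → ℝ) (-s)) (w - v) := by
  rw [← integral_indicator_one (measurableSet_Ioc.inter measurableSet_Ioc)]
  refine integral_congr_ae (Filter.Eventually.of_forall fun v => ?_)
  have h1 : -(w - v) ∈ Ioc 0 Δ ↔ v ∈ Ioc w (w + Δ) := by
    simp only [mem_Ioc]
    constructor <;> rintro ⟨h1, h2⟩ <;> constructor <;> linarith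
  simp only
  rw [inter_indicator_one, zero_add]
  simp only [Pi.mul_apply, indicator_apply, h1, Pi.one_apply]

theorem integrable_indicator_Ioc (Δ : ℝ) : Integrable ((Ioc 0 Δ).indicator (1 : ℝ → ℝ)) :=
  (integrable_indicator_iff measurableSet_Ioc).2 (integrableOn_const (by simp))

theorem integrable_overlap (Δ : ℝ) :
    Integrable fun w => volume.real (Ioc 0 (0 + Δ) ∩ Ioc w (w + Δ)) := by
  simp_rw [integral_indicator_mul_indicator]
  exact integrable_conv (integrable_indicator_Ioc Δ) (integrable_indicator_Ioc Δ).comp_neg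

theorem norm_fourierT_indicator_sq {Δ : ℝ} (hΔ : 0 < Δ) (ω : ℝ) :
    ‖fourierT ((Ioc 0 Δ).indicator (1 : ℝ → ℝ)) ω‖ ^ 2 = Δ ^ 2 * Real.sinc (ω * Δ / 2) ^ 2 := by
  have h0 : fourierT ((Ioc 0 Δ).indicator (1 : ℝ → ℝ)) ω =
      ∫ s in (0 : ℝ)..Δ, Complex.exp (-(Complex.I * ω) * s) := by
    rw [intervalIntegral.integral_of_le hΔ.le, ← integral_indicator measurableSet_Ioc, fourierT]
    refine integral_congr_ae (Filter.Eventually.of_forall fun s => ?_)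
    by_cases hs : s ∈ Ioc 0 Δ
    · simp [indicator_of_mem hs]
    · simp [indicator_of_notMem hs]
  rw [h0]
  rcases eq_or_ne ω 0 with rfl | hω
  · simp
  · have hc : -(Complex.I * (ω : ℂ)) ≠ 0 := by simp [hω]
    rw [integral_exp_mul_complex hc, Complex.ofReal_zero, mul_zero, Complex.exp_zero]
    have h1 : -(Complex.I * (ω : ℂ)) * (Δ : ℂ) = Complex.I * ((-(ω * Δ) : ℝ) : ℂ) := by
      push_cast; ring
    rw [h1, norm_div, Complex.norm_exp_I_mul_ofReal_sub_one, norm_neg, norm_mul, norm_mul, Complex.norm_I,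
      Complex.norm_real, Real.sinc_of_ne_zero (by positivity), div_pow, div_pow, mul_pow, one_mul,
      Real.norm_eq_abs, Real.norm_eq_abs, Real.norm_eq_abs, sq_abs, sq_abs, sq_abs, neg_div,
      Real.sin_neg]
    field_simp

theorem fourierT_overlap {Δ : ℝ} (hΔ : 0 < Δ) (ω : ℝ) :
    fourierT (fun w => volume.real (Ioc 0 (0 + Δ) ∩ Ioc w (w + Δ))) ω =
      ((Δ ^ 2 * Real.sinc (ω * Δ / 2) ^ 2 : ℝ) : ℂ) := by
  simp_rw [integral_indicator_mul_indicator]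
  rw [fourierT_conv (integrable_indicator_Ioc Δ) (integrable_indicator_Ioc Δ).comp_neg,
    fourierT_neg, Complex.mul_conj, Complex.normSq_eq_norm_sq, norm_fourierT_indicator_sq hΔ]

end Fourier

/-- A bounded continuous solution of a renewal equation with integrable inhomogeneity is integrable,
if the mass of the kernel is less than one: the largest integral of the modulus over a window of a
given length contracts. -/
theorem integrable_of_renewal {k f F : ℝ → ℝ} (hk : Integrable k) (hk0 : ∀ t, 0 ≤ k t)
    (hk1 : ∫ t, k t < 1) (hkm : Measurable k) (hf : Continuous f) {B : ℝ} (hB : ∀ w, |f w| ≤ B)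
    (hF : Integrable F) (heq : ∀ w, f w = (∫ v, k v * f (w - v)) + F w) : Integrable f := by
  refine ⟨hf.aestronglyMeasurable, ?_⟩
  set ρ := ∫ t, k t with hρ
  have hρ0 : 0 ≤ ρ := integral_nonneg hk0
  have hρe : ENNReal.ofReal ρ = ∫⁻ t, ENNReal.ofReal (k t) :=
    ofReal_integral_eq_lintegral_ofReal hk (Filter.Eventually.of_forall hk0)
  set φ := ∫⁻ w, ‖F w‖ₑ with hφ
  have hφfin : φ ≠ ∞ := hF.2.ne
  have hpt : ∀ w, ‖f w‖ₑ ≤ (∫⁻ v, ENNReal.ofReal (k v) * ‖f (w - v)‖ₑ) + ‖F w‖ₑ := fun w => by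
    rw [heq w]
    refine (enorm_add_le _ _).trans (add_le_add_left ?_ _)
    refine (enorm_integral_le_lintegral_enorm _).trans (le_of_eq ?_)
    refine lintegral_congr fun v => ?_
    rw [enorm_mul, Real.enorm_of_nonneg (hk0 v)]
  let a : ℝ → ℝ≥0∞ := fun R => ⨆ x : ℝ, ∫⁻ w in Ioc x (x + R), ‖f w‖ₑ
  have hbound : ∀ R, a R ≤ ENNReal.ofReal (φ.toReal / (1 - ρ)) := by
    intro R
    have hfin : a R ≠ ∞ := by
      refine ne_top_of_le_ne_top (b := ENNReal.ofReal B * ENNReal.ofReal R) (by finiteness) ?_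
      refine iSup_le fun x => ?_
      calc ∫⁻ w in Ioc x (x + R), ‖f w‖ₑ ≤ ∫⁻ w in Ioc x (x + R), ENNReal.ofReal B := by
            refine lintegral_mono fun w => ?_
            rw [← ofReal_norm, Real.norm_eq_abs]
            exact ENNReal.ofReal_le_ofReal (hB w)
        _ = _ := by rw [setLIntegral_const, Real.volume_Ioc, add_sub_cancel_left]
    have hle : a R ≤ ENNReal.ofReal ρ * a R + φ := by
      refine iSup_le fun x => ?_
      have hm : Measurable fun p : ℝ × ℝ => ENNReal.ofReal (k p.2) * ‖f (p.1 - p.2)‖ₑ :=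
        (hkm.comp measurable_snd).ennreal_ofReal.mul
          (hf.measurable.comp (measurable_fst.sub measurable_snd)).enorm
      calc ∫⁻ w in Ioc x (x + R), ‖f w‖ₑ
          ≤ ∫⁻ w in Ioc x (x + R), ((∫⁻ v, ENNReal.ofReal (k v) * ‖f (w - v)‖ₑ) + ‖F w‖ₑ) :=
            lintegral_mono fun w => hpt w
        _ = (∫⁻ w in Ioc x (x + R), ∫⁻ v, ENNReal.ofReal (k v) * ‖f (w - v)‖ₑ) +
              ∫⁻ w in Ioc x (x + R), ‖F w‖ₑ := lintegral_add_left hm.lintegral_prod_right' _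
        _ ≤ ENNReal.ofReal ρ * a R + φ := by
            refine add_le_add ?_ (setLIntegral_le_lintegral _ _)
            rw [lintegral_lintegral_swap hm.aemeasurable, hρe,
              ← lintegral_mul_const _ hkm.ennreal_ofReal]
            refine lintegral_mono fun v => ?_
            rw [lintegral_const_mul _ (show Measurable fun w => ‖f (w - v)‖ₑ from
              (hf.measurable.comp (measurable_id.sub_const v)).enorm)]
            refine mul_le_mul_right ?_ _
            refine le_iSup_of_le (x - v) (le_of_eq ?_)
            rw [← lintegral_indicator measurableSet_Ioc, ← lintegral_indicator measurableSet_Ioc,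
              ← lintegral_sub_right_eq_self
                (fun w => (Ioc (x - v) (x - v + R)).indicator (fun w => ‖f w‖ₑ) w) v]
            refine lintegral_congr fun w => ?_
            have h1 : w - v ∈ Ioc (x - v) (x - v + R) ↔ w ∈ Ioc x (x + R) := by
              simp only [mem_Ioc]
              constructor <;> rintro ⟨h1, h2⟩ <;> constructor <;> linarith
            simp only [indicator_apply, h1]
    rw [← ENNReal.ofReal_toReal hfin]
    refine ENNReal.ofReal_le_ofReal ?_
    have h5 := ENNReal.toReal_mono (by finiteness) hle
    rw [ENNReal.toReal_add (by finiteness) hφfin, ENNReal.toReal_mul,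
      ENNReal.toReal_ofReal hρ0] at h5
    rw [le_div_iff₀ (by linarith)]
    linarith
  refine lt_of_le_of_lt (lintegral_le_of_eventually_eq
    (f := fun (n : ℕ) w => (Ioc (-(n : ℝ)) (-n + 2 * n)).indicator (fun w => ‖f w‖ₑ) w)
    (fun n => hf.measurable.enorm.indicator measurableSet_Ioc) ?_
    (c := ENNReal.ofReal (φ.toReal / (1 - ρ))) fun n => ?_) ENNReal.ofReal_lt_top
  · refine Filter.Eventually.of_forall fun w => ?_
    obtain ⟨k, hk⟩ := exists_nat_gt |w|
    filter_upwards [Filter.eventually_ge_atTop k] with n hn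
    have hn' : (k : ℝ) ≤ n := by exact_mod_cast hn
    have := abs_lt.1 (hk.trans_le hn')
    exact indicator_of_mem (show w ∈ Ioc (-(n : ℝ)) (-n + 2 * n) from
      ⟨this.1, by linarith [this.2]⟩) _
  · rw [lintegral_indicator measurableSet_Ioc]
    exact (le_iSup (fun x : ℝ => ∫⁻ w in Ioc x (x + 2 * n), ‖f w‖ₑ) (-n)).trans (hbound (2 * n))

end

section

/-! ### The spectral density -/

theorem binCount_eq_count {Ω : Type*} (N : Ω → Measure ℝ) (Δ t : ℝ) : binCount N Δ t = count N Δ (t * Δ) := by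
  ext x
  simp only [binCount, count, add_mul, one_mul]

variable {Ω : Type*} [MeasurableSpace Ω] {P : Measure Ω} {N : Ω → Measure ℝ} {η : ℝ} {h : ℝ → ℝ}

/-- The correlation with a compensated increment solves a renewal equation with integrable
inhomogeneity. -/
theorem IsStationaryHawkes.integrable_corr_compensated (hN : IsStationaryHawkes P N η h)
    (hs : IsSubcritical η h) [IsProbabilityMeasure P] {Δ : ℝ} (hΔ : 0 ≤ Δ) :
    Integrable (corr P N Δ (compensated N η h 0 (0 + Δ))) := by
  have lM := hN.memLp_compensated hs 0 (0 + Δ)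
  obtain ⟨B, hB⟩ := hN.exists_forall_abs_corr_le hs Δ lM
  exact integrable_of_renewal hs.integrable hs.nonneg hs.integral_lt_one hs.measurable
    (hN.continuous_corr hs Δ lM) hB ((integrable_overlap Δ).const_mul (rate η h))
    (hN.corr_compensated_eq hs hΔ)

theorem IsStationaryHawkes.continuous_slidingCov (hN : IsStationaryHawkes P N η h)
    (hs : IsSubcritical η h) [IsProbabilityMeasure P] (Δ : ℝ) :
    Continuous (slidingCov P N η h Δ) :=
  (hN.continuous_corr hs Δ (hN.memLp_count' hs Δ 0)).sub continuous_const

theorem IsStationaryHawkes.slidingCov_eq' (hN : IsStationaryHawkes P N η h)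
    (hs : IsSubcritical η h) [IsProbabilityMeasure P] {Δ : ℝ} (hΔ : 0 ≤ Δ) (w : ℝ) :
    slidingCov P N η h Δ w = (∫ v, (fun s => h (-s)) v * slidingCov P N η h Δ (w - v)) +
      corr P N Δ (compensated N η h 0 (0 + Δ)) w := by
  rw [hN.slidingCov_eq hs hΔ w, ← integral_neg_eq_self (fun v => h v * slidingCov P N η h Δ (w + v))]
  simp_rw [← sub_eq_add_neg]

theorem IsStationaryHawkes.integrable_slidingCov (hN : IsStationaryHawkes P N η h)
    (hs : IsSubcritical η h) [IsProbabilityMeasure P] {Δ : ℝ} (hΔ : 0 ≤ Δ) :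
    Integrable (slidingCov P N η h Δ) := by
  obtain ⟨B, hB⟩ := hN.exists_forall_abs_corr_le hs Δ (hN.memLp_count' hs Δ 0)
  refine integrable_of_renewal hs.integrable.comp_neg (fun t => hs.nonneg (-t)) ?_
    (hs.measurable.comp measurable_neg) (hN.continuous_slidingCov hs Δ)
    (B := B + (rate η h * Δ) ^ 2) (fun w => ?_) (hN.integrable_corr_compensated hs hΔ)
    (hN.slidingCov_eq' hs hΔ)
  · rw [integral_neg_eq_self h]
    exact hs.integral_lt_one
  · refine (abs_sub _ _).trans ?_
    rw [abs_of_nonneg (sq_nonneg (rate η h * Δ))]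
    exact add_le_add_left (hB w) _

theorem IsSubcritical.one_sub_le_norm (hs : IsSubcritical η h) (ω : ℝ) :
    1 - ∫ t, h t ≤ ‖1 - fourierT h ω‖ := by
  have h1 := norm_fourierT_le h ω
  have h2 : ∫ t, |h t| = ∫ t, h t := by simp_rw [abs_of_nonneg (hs.nonneg _)]
  have h3 := norm_sub_norm_le (1 : ℂ) (fourierT h ω)
  rw [norm_one] at h3
  linarith

/-- The two renewal equations, solved in the frequency domain: one contributes the factor
`(1 - ĥ)⁻¹`, the time-reversed one its conjugate. -/
theorem IsStationaryHawkes.fourierT_slidingCov (hN : IsStationaryHawkes P N η h)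
    (hs : IsSubcritical η h) [IsProbabilityMeasure P] {Δ : ℝ} (hΔ : 0 < Δ) (ω : ℝ) :
    fourierT (slidingCov P N η h Δ) ω =
      ((rate η h * (Δ ^ 2 * Real.sinc (ω * Δ / 2) ^ 2) * (‖1 - fourierT h ω‖ ^ 2)⁻¹ : ℝ) : ℂ) := by
  set β := corr P N Δ (compensated N η h 0 (0 + Δ))
  have iβ := hN.integrable_corr_compensated hs hΔ.le
  have iγ := hN.integrable_slidingCov hs hΔ.le
  have e1 : fourierT β ω = fourierT h ω * fourierT β ω +
      rate η h * ((Δ ^ 2 * Real.sinc (ω * Δ / 2) ^ 2 : ℝ) : ℂ) := by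
    conv_lhs => rw [show β = fun w => (∫ v, h v * β (w - v)) +
      rate η h * volume.real (Ioc 0 (0 + Δ) ∩ Ioc w (w + Δ)) from
        funext (hN.corr_compensated_eq hs hΔ.le)]
    rw [fourierT_add (integrable_conv hs.integrable iβ) ((integrable_overlap Δ).const_mul _),
      fourierT_conv hs.integrable iβ, fourierT_const_mul, fourierT_overlap hΔ]
  have e2 : fourierT (slidingCov P N η h Δ) ω =
      (starRingEnd ℂ) (fourierT h ω) * fourierT (slidingCov P N η h Δ) ω + fourierT β ω := by
    conv_lhs => rw [show slidingCov P N η h Δ = fun w =>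
      (∫ v, (fun s => h (-s)) v * slidingCov P N η h Δ (w - v)) + β w from
        funext (hN.slidingCov_eq' hs hΔ.le)]
    rw [fourierT_add (integrable_conv hs.integrable.comp_neg iγ) iβ,
      fourierT_conv hs.integrable.comp_neg iγ, fourierT_neg]
  have hpos : 0 < ‖1 - fourierT h ω‖ := by
    linarith [hs.one_sub_le_norm ω, hs.integral_lt_one]
  have hnorm : (1 - fourierT h ω) * (1 - (starRingEnd ℂ) (fourierT h ω)) =
      ((‖1 - fourierT h ω‖ ^ 2 : ℝ) : ℂ) := by
    rw [← Complex.normSq_eq_norm_sq, ← Complex.mul_conj]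
    simp
  have hne : ((‖1 - fourierT h ω‖ ^ 2 : ℝ) : ℂ) ≠ 0 := by
    exact_mod_cast (pow_pos hpos 2).ne'
  have key : fourierT (slidingCov P N η h Δ) ω * ((‖1 - fourierT h ω‖ ^ 2 : ℝ) : ℂ) =
      rate η h * ((Δ ^ 2 * Real.sinc (ω * Δ / 2) ^ 2 : ℝ) : ℂ) := by
    rw [← hnorm]
    linear_combination e1 + (1 - fourierT h ω) * e2
  rw [Complex.ofReal_mul, Complex.ofReal_inv, Complex.ofReal_mul, ← key,
    mul_inv_cancel_right₀ hne]

theorem IsStationaryHawkes.autocov_binCount (hN : IsStationaryHawkes P N η h)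
    (hs : IsSubcritical η h) [IsProbabilityMeasure P] {Δ : ℝ} (hΔ : 0 ≤ Δ) (u : ℝ) :
    autocov P (binCount N Δ) u = slidingCov P N η h Δ (u * Δ) := by
  rw [autocov, binCount_eq_count, binCount_eq_count, ← hN.covariance_count hs hΔ 0 (u * Δ),
    zero_mul, zero_add]

theorem sinc_sq_mul_le (ω : ℝ) : Real.sinc (ω / 2) ^ 2 ≤ 5 * (1 + ω ^ 2)⁻¹ := by
  rw [← div_eq_mul_inv, le_div_iff₀ (by positivity)]
  have h1 : Real.sinc (ω / 2) ^ 2 ≤ 1 := by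
    rw [← sq_abs]; exact pow_le_one₀ (abs_nonneg _) (Real.abs_sinc_le_one _)
  have h2 : Real.sinc (ω / 2) ^ 2 * ω ^ 2 ≤ 4 := by
    rcases eq_or_ne ω 0 with rfl | hω
    · simp
    · rw [Real.sinc_of_ne_zero (by simpa using hω)]
      have : (Real.sin (ω / 2) / (ω / 2)) ^ 2 * ω ^ 2 = 4 * Real.sin (ω / 2) ^ 2 := by
        field_simp; ring
      rw [this]
      linarith [Real.sin_sq_le_one (ω / 2)]
  linarith

theorem IsStationaryHawkes.isSecondOrderStationary (hN : IsStationaryHawkes P N η h)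
    (hs : IsSubcritical η h) [IsProbabilityMeasure P] {Δ : ℝ} (hΔ : 0 ≤ Δ) :
    IsSecondOrderStationary P (binCount N Δ) where
  memLp t := by
    rw [binCount_eq_count]
    exact hN.memLp_count' hs Δ _
  mean_eq t := by
    rw [binCount_eq_count, binCount_eq_count, hN.integral_count' hs hΔ, hN.integral_count' hs hΔ]
  cov_eq t u := by
    rw [hN.autocov_binCount hs hΔ, binCount_eq_count, binCount_eq_count, add_mul,
      hN.covariance_count hs hΔ]

end

end Hawkes

end

theorem mainTheorem6 {Ω : Type*} [MeasurableSpace Ω] (P : Measure Ω) [IsProbabilityMeasure P]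
    (N : Ω → Measure ℝ) (η : ℝ) (hη : 0 < η)
    (h : ℝ → ℝ) (h_meas : Measurable h) (h_nonneg : ∀ t, 0 ≤ h t) (h_neg : ∀ t, t < 0 → h t = 0)
    (h_int : Integrable h) (h_lt : ∫ t, h t < 1)
    (hN : Hawkes.IsStationaryHawkes P N η h) (Δ : ℝ) (hΔ : 0 < Δ) :
    Hawkes.meanIntensity P N = η / (1 - ∫ t, h t) ∧
    Hawkes.HasSpectralDensity P (Hawkes.binCount N Δ)
      (fun ω => Hawkes.meanIntensity P N * Δ * Real.sinc (ω / 2) ^ 2 *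
        (‖1 - Hawkes.fourierT h (ω / Δ)‖ ^ 2)⁻¹) := by
  have hs : Hawkes.IsSubcritical η h := ⟨hη.le, h_meas, h_nonneg, h_neg, h_int, h_lt⟩
  have hm : Hawkes.meanIntensity P N = Hawkes.rate η h := by
    have := hN.integral_count hs zero_le_one
    rwa [sub_zero, mul_one] at this
  refine ⟨hm, ?_⟩
  have hr : Hawkes.autocov P (Hawkes.binCount N Δ) =
      fun u => Hawkes.slidingCov P N η h Δ (u * Δ) := funext (hN.autocov_binCount hs hΔ.le)
  have hrint : Integrable (Hawkes.autocov P (Hawkes.binCount N Δ)) := by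
    rw [hr]
    exact (hN.integrable_slidingCov hs hΔ.le).comp_mul_right' hΔ.ne'
  have hrcont : Continuous (Hawkes.autocov P (Hawkes.binCount N Δ)) := by
    rw [hr]
    exact (hN.continuous_slidingCov hs Δ).comp (by fun_prop)
  set f : ℝ → ℝ := fun ω => Hawkes.meanIntensity P N * Δ * Real.sinc (ω / 2) ^ 2 *
    (‖1 - Hawkes.fourierT h (ω / Δ)‖ ^ 2)⁻¹ with hf
  have hdens : ∀ ω : ℝ, (f ω : ℂ) =
      Hawkes.fourierT (Hawkes.autocov P (Hawkes.binCount N Δ)) ω := fun ω => by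
    rw [hr, Hawkes.fourierT_comp_mul hΔ, hN.fourierT_slidingCov hs hΔ, hf, hm,
      div_mul_cancel₀ _ hΔ.ne', ← Complex.ofReal_inv, ← Complex.ofReal_mul]
    congr 1
    field_simp
  have hm0 : 0 ≤ Hawkes.meanIntensity P N := hm ▸ hs.rate_nonneg
  have hf0 : ∀ ω, 0 ≤ f ω := fun ω => by positivity
  have hfcont : Continuous f := by
    have : f = fun ω => (Hawkes.fourierT (Hawkes.autocov P (Hawkes.binCount N Δ)) ω).re :=
      funext fun ω => by rw [← hdens, Complex.ofReal_re]
    rw [this]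
    exact Complex.continuous_re.comp (Hawkes.continuous_fourierT hrint)
  have hfint : Integrable f := by
    refine (integrable_inv_one_add_sq.const_mul (Hawkes.meanIntensity P N * Δ * 5 *
      ((1 - ∫ t, h t) ^ 2)⁻¹)).mono' hfcont.aestronglyMeasurable
      (Filter.Eventually.of_forall fun ω => ?_)
    have h0 : 0 < 1 - ∫ t, h t := by linarith
    have h1 : (‖1 - Hawkes.fourierT h (ω / Δ)‖ ^ 2)⁻¹ ≤ ((1 - ∫ t, h t) ^ 2)⁻¹ :=
      inv_anti₀ (by positivity) (pow_le_pow_left₀ h0.le (hs.one_sub_le_norm _) 2)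
    rw [Real.norm_of_nonneg (hf0 ω)]
    calc f ω ≤ Hawkes.meanIntensity P N * Δ * (5 * (1 + ω ^ 2)⁻¹) * ((1 - ∫ t, h t) ^ 2)⁻¹ := by
          simp only [hf]
          gcongr
          exact Hawkes.sinc_sq_mul_le ω
      _ = _ := by ring
  have hFint : Integrable (Hawkes.fourierT (Hawkes.autocov P (Hawkes.binCount N Δ))) :=
    (hfint.ofReal (𝕜 := ℂ)).congr (Filter.Eventually.of_forall hdens)
  refine ⟨hN.isSecondOrderStationary hs hΔ.le, hf0, hfint, hrint, hdens, fun u => ?_⟩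
  simp_rw [hdens]
  exact Hawkes.fourierT_inversion hrint hrcont hFint u
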